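/- Let $G=(V,E)$ be a finite hypergraph, $E\subseteq\mathcal P(V)$, and let $f=\{f_e : e\in E\}$, where $f_e$ is a probability measure on the symmetric group $\mathcal S_e$ of the elements of $e$; a permutation in $\mathcal S_e$ is extended to $V$ by the identity off $e$. For $k\in\mathbb N$, the $k$-particle exclusion process $\mathrm{EX}(k,f,G)$ is the continuous-time Markov chain on $\binom Vk=\{A\subseteq V: |A|=k\}$ with generator $$U^{\mathrm{EX}}h(A)=\sum_{B\in\binom Vk}\ \sum_{e\in E}\ \sum_{\sigma\in\mathcal S_e:\ \sigma(A)=B} f_e(\sigma)\,\bigl(h(B)-h(A)\bigr),$$ and the $k$-particle interchange process $\mathrm{IP}(k,f,G)$ is the chain on $k$-tuples of distinct vertices that jumps from $\mathbf x$ to $\mathbf y$ at rate $\sum_{e\in E}\sum_{\sigma\in\mathcal S_e:\,\sigma(\mathbf x)=\mathbf y}f_e(\sigma)$, where $\sigma$ acts coordinatewise. For a continuous-time Markov chain $X$ on a finite set $\Omega$ with transition probabilities $q_t(x,y)$ and equilibrium distribution $\pi$, let $$T_X(\varepsilon)=\inf\Bigl\{t\ge 0:\ \max_{x\in\Omega}\|q_t(x,\cdot)-\pi\|_{\mathrm{TV}}\le\varepsilon\Bigr\},\qquad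 \|\mu-\nu\|_{\mathrm{TV}}=\max_{A\subseteq\Omega}(\mu(A)-\nu(A)).$$ There is a universal constant $\lambda>0$ such that the following holds for every finite hypergraph $G=(V,E)$ with $|V|\ge 36$ and every $f$ as above. Suppose that $G$ is regular (every vertex lies in the same number of edges) and that 1. for every $e\in E$, $f_e$ is constant on the conjugacy classes of $\mathcal S_e$; 2. for every $e\in E$ and every $v\in e$, $\ f_e(\{\sigma\in\mathcal S_e:\sigma(v)=v\})\le 1/5$; 3. for every $k\in\{1,\dots,|V|-1\}$, the process $\mathrm{IP}(k,f,G)$ is irreducible. Then $$T_{\mathrm{EX}(4,f,G)}(1/4)\ \le\ \lambda\, T_{\mathrm{EX}(2,f,G)}(1/4).$$ -/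

import Mathlib

/-!
Exclusion and interchange processes on a finite hypergraph with vertex set `V` and edge set
`E : Finset (Finset V)`, and total variation mixing times of finite continuous-time Markov chains.
-/

namespace HypEx

noncomputable section

open scoped ENNReal NNReal

/-! ### Finite continuous-time Markov chains -/

section Chains

variable {Ω : Type*} [Fintype Ω] [DecidableEq Ω]

/-- The generator of the continuous-time Markov chain which jumps from `x` to `y` at rate `r x y`. -/
def generator (r : Ω → Ω → ℝ) : Matrix Ω Ω ℝ :=
  Matrix.of r - Matrix.diagonal fun x => ∑ y, r x y

/-- The generator acts on functions by `h ↦ ∑ y, r x y * (h y - h x)`. -/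
theorem generator_mulVec (r : Ω → Ω → ℝ) (h : Ω → ℝ) (x : Ω) :
    (generator r).mulVec h x = ∑ y, r x y * (h y - h x) := by
  rw [generator, Matrix.sub_mulVec, Pi.sub_apply, Matrix.mulVec_diagonal, Finset.sum_mul]
  simp [Matrix.mulVec, dotProduct, mul_sub]

/-- The matrix of transition probabilities `q_t(x, y)` of the chain with jump rates `r`. -/
def transition (r : Ω → Ω → ℝ) (t : ℝ) : Matrix Ω Ω ℝ :=
  NormedSpace.exp (t • generator r)

/-- `p` is (the mass function of) an equilibrium distribution of the chain with jump rates `r`. -/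
structure IsEquilibrium (r : Ω → Ω → ℝ) (p : Ω → ℝ) : Prop where
  nonneg : ∀ x, 0 ≤ p x
  sum_eq_one : ∑ x, p x = 1
  invariant : ∀ t : ℝ, 0 ≤ t → Matrix.vecMul p (transition r t) = p

/-- Total variation distance `max_A (μ(A) - ν(A))` of two mass functions on a finite set. -/
def tvDist (μ ν : Ω → ℝ) : ℝ :=
  ⨆ A : Finset Ω, (∑ x ∈ A, μ x - ∑ x ∈ A, ν x)

/-- The total variation `ε`-mixing time: the infimum of the times `t ≥ 0` such that the law at time
`t` is within `ε` of equilibrium for every initial state. It is `∞` if there is no such time.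
A finite chain always has an equilibrium distribution, and only one if it is irreducible. -/
def mixingTime (r : Ω → Ω → ℝ) (ε : ℝ) : ℝ≥0∞ :=
  ⨅ (t : ℝ≥0) (_ : ∀ p : Ω → ℝ, IsEquilibrium r p → ∀ x, tvDist (transition r t x) p ≤ ε),
    (t : ℝ≥0∞)

/-- Irreducibility: every state can be reached from every state by jumps of positive rate. -/
def IsIrreducible (r : Ω → Ω → ℝ) : Prop :=
  ∀ x y, Relation.ReflTransGen (fun a b => 0 < r a b) x y

end Chains

/-! ### Processes on hypergraphs -/

section Processes

variable {V : Type*} [Fintype V] [DecidableEq V]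

/-- A family of real weights on the symmetric groups of the edges. -/
abbrev EdgeWeights (E : Finset (Finset V)) : Type _ :=
  ∀ e : {e // e ∈ E}, Equiv.Perm {v // v ∈ e.1} → ℝ

/-- Every `f e` is a probability measure on the symmetric group of `e`. -/
def IsProbability {E : Finset (Finset V)} (f : EdgeWeights E) : Prop :=
  ∀ e, (∀ σ, 0 ≤ f e σ) ∧ ∑ σ, f e σ = 1

/-- The hypergraph is regular: all vertices lie in the same number of edges. -/
def IsRegular (E : Finset (Finset V)) : Prop :=
  ∃ D : ℕ, ∀ v : V, (E.filter fun e => v ∈ e).card = D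

/-- A permutation of the vertices of `e`, extended to `V` by the identity. -/
abbrev extend {e : Finset V} (σ : Equiv.Perm {v // v ∈ e}) : Equiv.Perm V :=
  Equiv.Perm.ofSubtype σ

/-- The jump rates of the `k`-particle exclusion process: from `A` to `B` at rate
`∑ e, ∑ (σ : σ(A) = B), f e σ`. -/
def exclusionRate (k : ℕ) {E : Finset (Finset V)} (f : EdgeWeights E)
    (A B : {A : Finset V // A.card = k}) : ℝ :=
  ∑ e, ∑ σ : Equiv.Perm {v // v ∈ e.1}, if A.1.image (extend σ) = B.1 then f e σ else 0

/-- The jump rates of the `k`-particle interchange process, on `k`-tuples of distinct vertices. -/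
def interchangeRate (k : ℕ) {E : Finset (Finset V)} (f : EdgeWeights E)
    (x y : Fin k ↪ V) : ℝ :=
  ∑ e, ∑ σ : Equiv.Perm {v // v ∈ e.1}, if ∀ i, extend σ (x i) = y i then f e σ else 0

/-- The mixing time `T_{EX(k,f,G)}(ε)`. -/
def exclusionMixingTime (k : ℕ) {E : Finset (Finset V)} (f : EdgeWeights E) (ε : ℝ) : ℝ≥0∞ :=
  mixingTime (exclusionRate k f) ε

/-- The standing assumptions on the family of probability measures `f`. -/
structure Admissible {E : Finset (Finset V)} (f : EdgeWeights E) : Prop where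
  /-- `f e` is constant on conjugacy classes. -/
  classFunction : ∀ e, ∀ σ τ : Equiv.Perm {v // v ∈ e.1}, IsConj σ τ → f e σ = f e τ
  /-- Every vertex of `e` is a fixed point with probability at most `1/5`. -/
  fixedPoint : ∀ e, ∀ v : {v // v ∈ e.1},
    (∑ σ : Equiv.Perm {v // v ∈ e.1}, if σ v = v then f e σ else 0) ≤ 1 / 5
  /-- The interchange process is irreducible for every number of particles below `|V|`. -/
  irreducible : ∀ k : ℕ, 1 ≤ k → k ≤ Fintype.card V - 1 → IsIrreducible (interchangeRate k f)

end Processes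

end

end HypEx

/-!
Exclusion with four particles mixes at most a constant factor slower than with two.

All processes are driven by the same rings: an edge `e` rings at rate one and a permutation drawn
from `f e` is applied to everything living on `V`. The law of a process is encoded dually, through
the semigroup `heat` of its generator acting on functions, and "mixing by time `t`" becomes
`OscContracts`: the semigroup contracts the oscillation of every function by a factor `ρ`. This is
submultiplicative in time, and a lumping of one process into another is an intertwining of the
generators, hence of the semigroups.

After a multiple `b` of the mixing time of two particles the oscillation for two particles is
contracted by a factor `2 ^ (-14)`. Say that two labelled particles meet when an edge containing
both rings, and consider the probability that a uniform pair of distinct particles meets by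
time `b`.

* If it is at most `1 / 2000`, then, except on a rare event, labelled particles started from
  mixed positions move as if they were independent, and independent particles mix as soon as single
  particles do (`oscContracts_of_rarely_meet`).
* Otherwise all pairs meet with probability bounded below by time `2 * b`, hence with probability
  close to one by a bounded multiple of `b`. Consider two configurations which differ in a single
  particle, at `d` in one and at `z` in the other. When an edge `e` containing `d` and `z` rings, the
  conjugation invariance of `f e` and the bound on fixed points allow the two copies to be coupled so
  that they coalesce with probability at least `1 / 60` (`exists_coalescing`), unless `e` has four
  vertices exactly one of which carries a common particle. If `d` is fixed and `z` is uniform on the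
  remaining vertices, this obstruction at the first meeting has small probability: for each of the
  three common particles `a`, an edge of four vertices containing `d` and `z` has only two places for
  `a`, so that after mixing `a` is present for about two of the `|V| - 3` choices of `z`
  (`sum_thirdMeet_le`); using the bound on oscillations costs another factor two. Since
  `12 / (|V| - 3) < 1 / 2` for `|V| ≥ 36`, the average over `z` of the probability of not having
  coalesced is below `1 / 2` (`sum_heat_coalGen_le`), and comparing both configurations with one
  whose last particle is uniform shows that the semigroup contracts the differences between
  adjacent configurations (`oscContracts_of_coalescence`).
-/

namespace HypEx

noncomputable section

open scoped ENNReal NNReal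

/-! ### Semigroups of linear operators on functions on a finite set -/

section Semigroup

variable {X Y : Type*} [Fintype X] [Fintype Y]

/-- The semigroup `exp (t A)` generated by a linear operator `A` on real functions on a finite set,
applied to the function `u`. -/
def heat (A : (X → ℝ) →ₗ[ℝ] (X → ℝ)) (t : ℝ) (u : X → ℝ) : X → ℝ :=
  NormedSpace.exp (t • A.toContinuousLinearMap) u

variable (A : (X → ℝ) →ₗ[ℝ] (X → ℝ))

@[simp] theorem heat_zero (u : X → ℝ) : heat A 0 u = u := by
  simp [heat]

theorem heat_add_fun (t : ℝ) (u v : X → ℝ) : heat A t (u + v) = heat A t u + heat A t v := by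
  simp [heat]

theorem heat_sub_fun (t : ℝ) (u v : X → ℝ) : heat A t (u - v) = heat A t u - heat A t v := by
  simp [heat]

theorem heat_smul_fun (t c : ℝ) (u : X → ℝ) : heat A t (c • u) = c • heat A t u := by
  simp [heat]

theorem heat_sum_fun {ι : Type*} (s : Finset ι) (t : ℝ) (u : ι → X → ℝ) :
    heat A t (∑ i ∈ s, u i) = ∑ i ∈ s, heat A t (u i) := by
  simp [heat]

theorem hasDerivAt_heat (t : ℝ) (u : X → ℝ) :
    HasDerivAt (fun s => heat A s u) (A (heat A t u)) t := by
  have h := (hasDerivAt_exp_smul_const' A.toContinuousLinearMap t).clm_apply (hasDerivAt_const t u)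
  simpa [heat] using h

theorem heat_apply_generator (t : ℝ) (u : X → ℝ) : heat A t (A u) = A (heat A t u) := by
  have h := (hasDerivAt_exp_smul_const A.toContinuousLinearMap t).clm_apply (hasDerivAt_const t u)
  have h2 := (hasDerivAt_heat A t u).unique (by simpa [heat] using h)
  rw [h2]; simp [heat]

/-- Variation of constants. -/
theorem hasDerivAt_heat_sub {y y' : ℝ → X → ℝ} (t : ℝ) {s : ℝ} (hy : HasDerivAt y (y' s) s) :
    HasDerivAt (fun r => heat A (t - r) (y r)) (heat A (t - s) (y' s - A (y s))) s := by
  have h0 : HasDerivAt (fun r : ℝ => t - r) (-1) s := by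
    simpa using (hasDerivAt_id s).const_sub t
  have h1 := (hasDerivAt_exp_smul_const' A.toContinuousLinearMap (t - s)).scomp s h0
  have h2 := h1.clm_apply hy
  refine h2.congr_deriv ?_
  rw [heat_sub_fun, heat_apply_generator]
  simp [heat]
  abel

theorem eq_heat {y : ℝ → X → ℝ} (hy : ∀ s, HasDerivAt y (A (y s)) s) (t : ℝ) :
    y t = heat A t (y 0) := by
  have h : ∀ s, HasDerivAt (fun r => heat A (t - r) (y r)) 0 s := fun s => by
    simpa [heat] using hasDerivAt_heat_sub A (y' := fun s => A (y s)) t (hy s)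
  have := is_const_of_deriv_eq_zero (fun s => (h s).differentiableAt) (fun s => (h s).deriv) t 0
  simpa using this

/-- An operator `T` which intertwines two generators intertwines their semigroups. -/
theorem map_heat {B : (Y → ℝ) →ₗ[ℝ] (Y → ℝ)} (T : (X → ℝ) →ₗ[ℝ] (Y → ℝ))
    (hT : ∀ u, T (A u) = B (T u)) (t : ℝ) (u : X → ℝ) : T (heat A t u) = heat B t (T u) := by
  have h := eq_heat B (y := fun s => T (heat A s u)) (fun s => ?_) t
  · simpa using h
  · rw [← hT]
    exact T.toContinuousLinearMap.hasFDerivAt.comp_hasDerivAt s (hasDerivAt_heat A s u)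

theorem heat_add (s t : ℝ) (u : X → ℝ) : heat A (s + t) u = heat A s (heat A t u) := by
  have h := eq_heat A (y := fun s => heat A (s + t) u)
    (fun s => by simpa using (hasDerivAt_heat A (s + t) u).comp_add_const s t) s
  simpa using h

theorem heat_eq_self {u : X → ℝ} (hu : A u = 0) (t : ℝ) : heat A t u = u :=
  (eq_heat A (y := fun _ => u) (fun s => by rw [hu]; exact hasDerivAt_const s u) t).symm

/-- The operator `A` has nonnegative off-diagonal coefficients: some translate `A + κ` preserves
nonnegativity. -/
def QuasiPositive : Prop := ∃ κ : ℝ, ∀ u : X → ℝ, 0 ≤ u → 0 ≤ A u + κ • u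

theorem heat_nonneg_of_positive (hA : ∀ u : X → ℝ, 0 ≤ u → 0 ≤ A u) {t : ℝ} (ht : 0 ≤ t)
    {u : X → ℝ} (hu : 0 ≤ u) : 0 ≤ heat A t u := by
  have hs := NormedSpace.exp_series_hasSum_exp' (𝕂 := ℝ) (t • A.toContinuousLinearMap)
  have hs' := (ContinuousLinearMap.apply ℝ (X → ℝ) u).hasSum hs
  have hp : ∀ n : ℕ, 0 ≤ ((t • A.toContinuousLinearMap) ^ n) u := by
    intro n
    induction n with
    | zero => simpa using hu
    | succ n ih =>
      rw [pow_succ']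
      simpa using smul_nonneg ht (hA _ ih)
  intro x
  have hx := (Pi.hasSum.1 hs') x
  refine hx.nonneg fun n => ?_
  have := hp n x
  simp only [ContinuousLinearMap.apply_apply, smul_apply, Pi.smul_apply]
  exact smul_nonneg (by positivity) this

variable {A}

theorem heat_nonneg (hA : QuasiPositive A) {t : ℝ} (ht : 0 ≤ t) {u : X → ℝ} (hu : 0 ≤ u) :
    0 ≤ heat A t u := by
  obtain ⟨κ, hκ⟩ := hA
  have h := eq_heat A (y := fun s => Real.exp (-κ * s) • heat (A + κ • LinearMap.id) s u)
    (fun s => ?_) t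
  · simp only [mul_zero, Real.exp_zero, heat_zero, one_smul] at h
    rw [← h]
    exact smul_nonneg (Real.exp_nonneg _)
      (heat_nonneg_of_positive _ (fun v hv => by simpa using hκ v hv) ht hu)
  · have h1 : HasDerivAt (fun s => Real.exp (-κ * s)) (-κ * Real.exp (-κ * s)) s := by
      have := ((hasDerivAt_id s).const_mul (-κ)).exp
      simpa [mul_comm] using this
    refine (h1.smul (hasDerivAt_heat (A + κ • LinearMap.id) s u)).congr_deriv ?_
    simp only [map_smul, LinearMap.add_apply, LinearMap.smul_apply, LinearMap.id_apply, smul_add,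
      smul_smul]
    rw [add_assoc, ← add_smul]
    simp [mul_comm]

theorem heat_mono (hA : QuasiPositive A) {t : ℝ} (ht : 0 ≤ t) {u v : X → ℝ} (huv : u ≤ v) :
    heat A t u ≤ heat A t v := by
  have := heat_nonneg hA ht (sub_nonneg.2 huv)
  rwa [heat_sub_fun, sub_nonneg] at this

/-- The comparison principle: a supersolution that starts nonnegative stays nonnegative. -/
theorem nonneg_of_supersolution (hA : QuasiPositive A) {y y' : ℝ → X → ℝ}
    (hy : ∀ s, HasDerivAt y (y' s) s) (hy' : ∀ s, 0 ≤ s → A (y s) ≤ y' s) (h0 : 0 ≤ y 0)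
    {t : ℝ} (ht : 0 ≤ t) : 0 ≤ y t := by
  intro x
  have hd : ∀ s, HasDerivAt (fun r => heat A (t - r) (y r) x) (heat A (t - s) (y' s - A (y s)) x) s :=
    fun s => hasDerivAt_pi.1 (hasDerivAt_heat_sub A t (hy s)) x
  have hm : MonotoneOn (fun r => heat A (t - r) (y r) x) (Set.Icc 0 t) := by
    refine monotoneOn_of_deriv_nonneg (convex_Icc 0 t)
      (fun s _ => (hd s).continuousAt.continuousWithinAt)
      (fun s _ => (hd s).differentiableAt.differentiableWithinAt) fun s hs => ?_
    rw [interior_Icc] at hs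
    rw [(hd s).deriv]
    exact heat_nonneg hA (by linarith [hs.2]) (sub_nonneg.2 (hy' s hs.1.le)) x
  have h1 := hm (Set.left_mem_Icc.2 ht) (Set.right_mem_Icc.2 ht) ht
  simp only [sub_zero, sub_self, heat_zero] at h1
  exact (heat_nonneg hA ht h0 x).trans h1

/-- Larger generators have larger semigroups. -/
theorem heat_le_heat {B : (X → ℝ) →ₗ[ℝ] (X → ℝ)} (hA : QuasiPositive A) (hB : QuasiPositive B)
    (hAB : ∀ u : X → ℝ, 0 ≤ u → A u ≤ B u) {t : ℝ} (ht : 0 ≤ t) {u : X → ℝ} (hu : 0 ≤ u) :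
    heat A t u ≤ heat B t u := by
  have h := nonneg_of_supersolution hB (y := fun s => heat B s u - heat A s u)
    (y' := fun s => B (heat B s u) - A (heat A s u))
    (fun s => (hasDerivAt_heat B s u).sub (hasDerivAt_heat A s u)) (fun s hs => ?_) (by simp) ht
  · exact sub_nonneg.1 h
  · rw [map_sub]
    exact sub_le_sub_left (hAB _ (heat_nonneg hA hs hu)) _

theorem heat_const (hA : A 1 = 0) (t c : ℝ) : heat A t (fun _ => c) = fun _ => c := by
  refine heat_eq_self A ?_ t
  have : (fun _ : X => c) = c • (1 : X → ℝ) := by ext; simp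
  rw [this, map_smul, hA, smul_zero]

theorem heat_one_le (hA : QuasiPositive A) (h1 : A 1 ≤ 0) {t : ℝ} (ht : 0 ≤ t) :
    heat A t 1 ≤ 1 := by
  have h := nonneg_of_supersolution hA (y := fun s => 1 - heat A s 1)
    (y' := fun s => 0 - A (heat A s 1))
    (fun s => (hasDerivAt_const s (1 : X → ℝ)).sub (hasDerivAt_heat A s 1)) (fun s _ => ?_)
    (by simp) ht
  · exact sub_nonneg.1 h
  · rw [map_sub]
    exact sub_le_sub_right h1 _

theorem abs_heat_le (hA : QuasiPositive A) {t : ℝ} (ht : 0 ≤ t) {u v : X → ℝ}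
    (huv : ∀ x, |u x| ≤ v x) (x : X) : |heat A t u x| ≤ heat A t v x := by
  rw [abs_le]
  constructor
  · have h := heat_mono hA ht (u := -v) (v := u) (fun x => (abs_le.1 (huv x)).1) x
    rwa [← neg_one_smul ℝ v, heat_smul_fun, neg_one_smul] at h
  · exact heat_mono hA ht (u := u) (v := v) (fun x => (abs_le.1 (huv x)).2) x

variable (A)

/-- The accumulated flow `∫₀ᵗ exp (s A) u ds`. -/
def accum (t : ℝ) (u : X → ℝ) : X → ℝ := ∫ s in (0 : ℝ)..t, heat A s u

theorem continuous_heat (u : X → ℝ) : Continuous fun s => heat A s u :=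
  continuous_iff_continuousAt.2 fun s => (hasDerivAt_heat A s u).continuousAt

theorem hasDerivAt_accum (t : ℝ) (u : X → ℝ) :
    HasDerivAt (fun s => accum A s u) (heat A t u) t :=
  (continuous_heat A u).integral_hasStrictDerivAt 0 t |>.hasDerivAt

@[simp] theorem accum_zero (u : X → ℝ) : accum A 0 u = 0 := by simp [accum]

theorem map_accum {B : (Y → ℝ) →ₗ[ℝ] (Y → ℝ)} (T : (X → ℝ) →ₗ[ℝ] (Y → ℝ))
    (hT : ∀ u, T (A u) = B (T u)) (t : ℝ) (u : X → ℝ) : T (accum A t u) = accum B t (T u) := by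
  have := T.toContinuousLinearMap.intervalIntegral_comp_comm
    ((continuous_heat A u).intervalIntegrable (μ := MeasureTheory.volume) 0 t)
  simp only [LinearMap.coe_toContinuousLinearMap'] at this
  rw [accum, ← this, accum]
  simp only [map_heat A T hT]

theorem generator_accum (t : ℝ) (u : X → ℝ) : A (accum A t u) = heat A t u - u := by
  rw [map_accum A A (fun _ => rfl)]
  have h := intervalIntegral.integral_eq_sub_of_hasDerivAt (a := 0) (b := t)
    (fun s _ => hasDerivAt_heat A s u)
    (((continuous_heat A (A u)).congr fun s => heat_apply_generator A s u).intervalIntegrable _ _)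
  simp only [heat_zero] at h
  rw [← h, accum]
  simp only [heat_apply_generator]

theorem accum_add_fun (t : ℝ) (u v : X → ℝ) : accum A t (u + v) = accum A t u + accum A t v := by
  simp only [accum, heat_add_fun]
  exact intervalIntegral.integral_add ((continuous_heat A u).intervalIntegrable _ _)
    ((continuous_heat A v).intervalIntegrable _ _)

theorem accum_generator (t : ℝ) (u : X → ℝ) : accum A t (A u) = heat A t u - u := by
  rw [← generator_accum, map_accum A A (fun _ => rfl)]

variable {A}

theorem accum_nonneg (hA : QuasiPositive A) {t : ℝ} (ht : 0 ≤ t) {u : X → ℝ} (hu : 0 ≤ u) :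
    0 ≤ accum A t u := by
  intro x
  have h := (ContinuousLinearMap.proj (R := ℝ) (φ := fun _ : X => ℝ) x).intervalIntegral_comp_comm
    ((continuous_heat A u).intervalIntegrable (μ := MeasureTheory.volume) 0 t)
  simp only [ContinuousLinearMap.proj_apply] at h
  rw [accum, ← h]
  exact intervalIntegral.integral_nonneg ht fun s hs => heat_nonneg hA hs.1 hu x

theorem accum_neg_fun (t : ℝ) (u : X → ℝ) : accum A t (-u) = - accum A t u := by
  have : accum A t (-u + u) = accum A t (-u) + accum A t u := accum_add_fun A t _ _
  rw [neg_add_cancel] at this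
  have h0 : accum A t (0 : X → ℝ) = 0 := by simp [accum, heat]
  rw [h0] at this
  exact eq_neg_of_add_eq_zero_left this.symm

theorem accum_mono (hA : QuasiPositive A) {t : ℝ} (ht : 0 ≤ t) {u v : X → ℝ} (huv : u ≤ v) :
    accum A t u ≤ accum A t v := by
  have h := accum_nonneg hA ht (sub_nonneg.2 huv)
  rw [sub_eq_add_neg, accum_add_fun, accum_neg_fun, ← sub_eq_add_neg] at h
  exact sub_nonneg.1 h

end Semigroup

/-! ### Generators built from the rings of the hyperedges -/

section JumpOperators

variable {V : Type*} [DecidableEq V] {E : Finset (Finset V)}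
variable {X Y : Type*}

/-- The operator of a process on `X` driven by the rings of the edges: at rate `f e σ` the state `x`
is replaced by `act σ x`, the jump being counted with weight `w e σ x`; the diagonal coefficient of
the edge `e` is `- b e x`. With all weights equal to `1` this is the generator of the process, and
smaller weights `w`, or larger `b`, mean killing. -/
def jumpOp (f : EdgeWeights E) (act : Equiv.Perm V → X → X)
    (w : ∀ e : {e // e ∈ E}, Equiv.Perm {v // v ∈ e.1} → X → ℝ) (b : {e // e ∈ E} → X → ℝ) :
    (X → ℝ) →ₗ[ℝ] (X → ℝ) where
  toFun u x := ∑ e, (∑ σ, f e σ * (w e σ x * u (act (extend σ) x)) - b e x * u x)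
  map_add' u v := by
    ext x
    simp only [Pi.add_apply, ← Finset.sum_add_distrib]
    refine Finset.sum_congr rfl fun e _ => ?_
    simp only [mul_add, Finset.sum_add_distrib]
    ring
  map_smul' c u := by
    ext x
    simp only [Pi.smul_apply, smul_eq_mul, RingHom.id_apply, Finset.mul_sum, mul_sub]
    refine Finset.sum_congr rfl fun e _ => ?_
    congr 1
    · exact Finset.sum_congr rfl fun σ _ => by ring
    · ring

variable {f : EdgeWeights E} {act : Equiv.Perm V → X → X}
  {w : ∀ e : {e // e ∈ E}, Equiv.Perm {v // v ∈ e.1} → X → ℝ} {b : {e // e ∈ E} → X → ℝ}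
  {act' : Equiv.Perm V → Y → Y}
  {w' : ∀ e : {e // e ∈ E}, Equiv.Perm {v // v ∈ e.1} → Y → ℝ} {b' : {e // e ∈ E} → Y → ℝ}

theorem jumpOp_apply (u : X → ℝ) (x : X) : jumpOp f act w b u x =
    ∑ e, (∑ σ, f e σ * (w e σ x * u (act (extend σ) x)) - b e x * u x) := rfl

theorem quasiPositive_jumpOp [Fintype X] (hf : IsProbability f) (hw : ∀ e σ x, 0 ≤ w e σ x) :
    QuasiPositive (jumpOp f act w b) := by
  refine ⟨∑ x, ∑ e, |b e x|, fun u hu x => ?_⟩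
  simp only [Pi.add_apply, jumpOp_apply, Pi.smul_apply, smul_eq_mul, Finset.sum_sub_distrib,
    ← Finset.sum_mul]
  have h1 : 0 ≤ ∑ e, ∑ σ, f e σ * (w e σ x * u (act (extend σ) x)) :=
    Finset.sum_nonneg fun e _ => Finset.sum_nonneg fun σ _ =>
      mul_nonneg ((hf e).1 σ) (mul_nonneg (hw e σ x) (hu _))
  have h2 : ∑ e, b e x ≤ ∑ x, ∑ e, |b e x| :=
    (Finset.sum_le_sum fun e _ => le_abs_self _).trans
      (Finset.single_le_sum (f := fun x => ∑ e, |b e x|)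
        (fun x _ => Finset.sum_nonneg fun e _ => abs_nonneg _) (Finset.mem_univ x))
  have h3 := mul_le_mul_of_nonneg_right h2 (hu x)
  simp only [Pi.zero_apply] at h3 ⊢
  linarith

theorem jumpOp_intertwine (T : (X → ℝ) →ₗ[ℝ] (Y → ℝ))
    (hw : ∀ e σ u y, T (fun x => w e σ x * u (act (extend σ) x)) y
      = w' e σ y * T u (act' (extend σ) y))
    (hb : ∀ e u y, T (fun x => b e x * u x) y = b' e y * T u y) (u : X → ℝ) :
    T (jumpOp f act w b u) = jumpOp f act' w' b' (T u) := by
  have h : jumpOp f act w b u = ∑ e, (∑ σ, f e σ • (fun x => w e σ x * u (act (extend σ) x))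
      - fun x => b e x * u x) := by
    ext x
    simp [jumpOp_apply]
  rw [h]
  ext y
  simp only [map_sum, map_sub, map_smul, jumpOp_apply, Finset.sum_apply, Pi.sub_apply, hb, hw,
    Pi.smul_apply, smul_eq_mul]

theorem jumpOp_comp {φ : Y → X} (hφ : ∀ g y, φ (act' g y) = act g (φ y))
    (hw : ∀ e σ y, w' e σ y = w e σ (φ y)) (hb : ∀ e y, b' e y = b e (φ y)) (u : X → ℝ) :
    jumpOp f act w b u ∘ φ = jumpOp f act' w' b' (u ∘ φ) := by
  ext y
  simp only [jumpOp_apply, Function.comp_apply, hφ, hw, hb]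

/-- The generator of the process on `X` driven by the rings of the edges. -/
abbrev ringGen (f : EdgeWeights E) (act : Equiv.Perm V → X → X) : (X → ℝ) →ₗ[ℝ] (X → ℝ) :=
  jumpOp f act (fun _ _ _ => 1) (fun _ _ => 1)

theorem ringGen_one (hf : IsProbability f) : ringGen f act 1 = 0 := by
  ext x
  simp [jumpOp_apply, (hf _).2]

theorem quasiPositive_ringGen [Fintype X] (hf : IsProbability f) :
    QuasiPositive (ringGen f act) :=
  quasiPositive_jumpOp hf fun _ _ _ => zero_le_one

theorem ringGen_intertwine (T : (X → ℝ) →ₗ[ℝ] (Y → ℝ))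
    (hT : ∀ g u y, T (fun x => u (act g x)) y = T u (act' g y)) (u : X → ℝ) :
    T (ringGen f act u) = ringGen f act' (T u) :=
  jumpOp_intertwine T (fun e σ u y => by simpa using hT _ u y) (fun e u y => by simp) u

theorem heat_comp [Fintype X] [Fintype Y] {A : (X → ℝ) →ₗ[ℝ] (X → ℝ)}
    {B : (Y → ℝ) →ₗ[ℝ] (Y → ℝ)} {φ : Y → X} (hφ : ∀ u, A u ∘ φ = B (u ∘ φ)) (t : ℝ) (u : X → ℝ)
    (y : Y) : heat A t u (φ y) = heat B t (u ∘ φ) y :=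
  congrFun (map_heat A (LinearMap.funLeft ℝ ℝ φ) hφ t u) y

theorem heat_ringGen_comp [Fintype X] [Fintype Y] {φ : Y → X}
    (hφ : ∀ g y, φ (act' g y) = act g (φ y)) (t : ℝ) (u : X → ℝ) (y : Y) :
    heat (ringGen f act) t u (φ y) = heat (ringGen f act') t (u ∘ φ) y := by
  refine heat_comp (fun u => ?_) t u y
  exact jumpOp_comp hφ (fun _ _ _ => rfl) (fun _ _ => rfl) u

theorem sum_heat_ringGen [Fintype X] (hf : IsProbability f) (hact : ∀ g, Function.Bijective (act g))
    (t : ℝ) (u : X → ℝ) : ∑ x, heat (ringGen f act) t u x = ∑ x, u x := by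
  let T : (X → ℝ) →ₗ[ℝ] (Unit → ℝ) := LinearMap.pi fun _ => ∑ x, LinearMap.proj x
  have hT : ∀ v i, T v i = ∑ x, v x := fun v i => by simp [T]
  have h := map_heat (ringGen f act) (B := 0) T (fun v => ?_) t u
  · have := congrFun h ()
    rwa [heat_eq_self 0 (by simp), hT, hT] at this
  · ext i
    rw [hT]
    simp only [jumpOp_apply, LinearMap.zero_apply, Pi.zero_apply, one_mul]
    rw [Finset.sum_comm]
    refine Finset.sum_eq_zero fun e _ => ?_
    rw [Finset.sum_sub_distrib, Finset.sum_comm]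
    simp only [← Finset.mul_sum]
    have : ∀ σ : Equiv.Perm {v // v ∈ e.1}, ∑ x, v (act (extend σ) x) = ∑ x, v x := fun σ =>
      Equiv.sum_comp (Equiv.ofBijective _ (hact (extend σ))) v
    simp only [this, ← Finset.sum_mul, (hf e).2, one_mul, sub_self]

/-- The operator of the process killed at rate `c` by each edge `e` with `S e x`. -/
abbrev killedGen (f : EdgeWeights E) (act : Equiv.Perm V → X → X) (S : {e // e ∈ E} → X → Prop)
    [∀ e x, Decidable (S e x)] (c : ℝ) : (X → ℝ) →ₗ[ℝ] (X → ℝ) :=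
  jumpOp f act (fun e _ x => if S e x then 0 else 1) (fun e x => if S e x then c else 1)

theorem quasiPositive_killedGen [Fintype X] (hf : IsProbability f) (S : {e // e ∈ E} → X → Prop)
    [∀ e x, Decidable (S e x)] (c : ℝ) : QuasiPositive (killedGen f act S c) :=
  quasiPositive_jumpOp hf fun e σ x => by split_ifs <;> norm_num

theorem killedGen_one (hf : IsProbability f) (S : {e // e ∈ E} → X → Prop)
    [∀ e x, Decidable (S e x)] (c : ℝ) (x : X) :
    killedGen f act S c 1 x = ∑ e, if S e x then - c else 0 := by
  rw [jumpOp_apply]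
  refine Finset.sum_congr rfl fun e _ => ?_
  by_cases h : S e x <;> simp [h, (hf e).2]

theorem killedGen_comp {S : {e // e ∈ E} → X → Prop} {S' : {e // e ∈ E} → Y → Prop}
    [∀ e x, Decidable (S e x)] [∀ e x, Decidable (S' e x)] {c : ℝ} {φ : Y → X}
    (hφ : ∀ g y, φ (act' g y) = act g (φ y)) (hS : ∀ e y, S' e y ↔ S e (φ y)) (u : X → ℝ) :
    killedGen f act S c u ∘ φ = killedGen f act' S' c (u ∘ φ) := by
  ext y
  simp only [jumpOp_apply, Function.comp_apply, hφ, hS]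

theorem killedGen_le_ringGen (hf : IsProbability f)
    (S : {e // e ∈ E} → X → Prop) [∀ e x, Decidable (S e x)] {c : ℝ} (hc : 1 ≤ c) {u : X → ℝ}
    (hu : 0 ≤ u) : killedGen f act S c u ≤ ringGen f act u := by
  intro x
  rw [jumpOp_apply, jumpOp_apply]
  refine Finset.sum_le_sum fun e _ => ?_
  refine sub_le_sub (Finset.sum_le_sum fun σ _ => mul_le_mul_of_nonneg_left
    (mul_le_mul_of_nonneg_right ?_ (hu _)) ((hf e).1 σ)) (mul_le_mul_of_nonneg_right ?_ (hu _))
  · split_ifs <;> norm_num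
  · split_ifs <;> linarith

end JumpOperators

/-! ### The exclusion process -/

section Exclusion

variable {Ω : Type*} [Fintype Ω] [DecidableEq Ω]

theorem transition_mulVec (r : Ω → Ω → ℝ) (t : ℝ) (h : Ω → ℝ) :
    (transition r t).mulVec h = heat (Matrix.toLin' (generator r)) t h := by
  let _ : NormedRing (Matrix Ω Ω ℝ) := Matrix.linftyOpNormedRing
  let _ : NormedAlgebra ℝ (Matrix Ω Ω ℝ) := Matrix.linftyOpNormedAlgebra
  let T : Matrix Ω Ω ℝ →ₗ[ℝ] (Ω → ℝ) :=
    { toFun := fun M => M.mulVec h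
      map_add' := fun M N => Matrix.add_mulVec M N h
      map_smul' := fun c M => Matrix.smul_mulVec c M h }
  have hd : ∀ s : ℝ, HasDerivAt (fun s => (transition r s).mulVec h)
      (Matrix.toLin' (generator r) ((transition r s).mulVec h)) s := fun s => by
    have h1 := hasDerivAt_exp_smul_const' (generator r) s
    have h2 := T.toContinuousLinearMap.hasFDerivAt.comp_hasDerivAt s h1
    have h3 : Matrix.toLin' (generator r) ((transition r s).mulVec h)
        = T (generator r * NormedSpace.exp (s • generator r)) := by
      simp [T, transition, Matrix.mulVec_mulVec]
    rw [h3]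
    exact h2
  have := eq_heat _ hd t
  simpa [transition] using this

variable {V : Type*} [DecidableEq V] {E : Finset (Finset V)} {f : EdgeWeights E}

/-- The action of permutations on sets of size `k`. -/
def setAct (k : ℕ) (g : Equiv.Perm V) (A : {A : Finset V // A.card = k}) :
    {A : Finset V // A.card = k} :=
  ⟨A.1.image g, by rw [Finset.card_image_of_injective _ g.injective, A.2]⟩

theorem setAct_bijective [Fintype V] (k : ℕ) (g : Equiv.Perm V) :
    Function.Bijective (setAct k g) := by
  have : Function.Injective (setAct k g) := fun A B h => by
    have := congrArg Subtype.val h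
    exact Subtype.ext (Finset.image_injective g.injective this)
  exact Finite.injective_iff_bijective.1 this

variable [Fintype V]

theorem generator_exclusionRate (hf : IsProbability f) (k : ℕ) :
    Matrix.toLin' (generator (exclusionRate k f)) = ringGen f (setAct k) := by
  refine LinearMap.ext fun h => funext fun A => ?_
  rw [Matrix.toLin'_apply, generator_mulVec, jumpOp_apply]
  simp only [exclusionRate, Finset.sum_mul]
  rw [Finset.sum_comm]
  refine Finset.sum_congr rfl fun e _ => ?_
  rw [Finset.sum_comm]
  have : ∀ σ : Equiv.Perm {v // v ∈ e.1}, ∑ B : {A : Finset V // A.card = k},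
      (if A.1.image (extend σ) = B.1 then f e σ else 0) * (h B - h A)
      = f e σ * (h (setAct k (extend σ) A) - h A) := fun σ => by
    rw [Finset.sum_eq_single (setAct k (extend σ) A)]
    · simp [setAct]
    · intro B _ hB
      rw [if_neg, zero_mul]
      exact fun h => hB (Subtype.ext h.symm)
    · simp
  rw [Finset.sum_congr rfl fun σ _ => this σ]
  simp only [mul_sub, Finset.sum_sub_distrib, ← Finset.sum_mul, (hf e).2, one_mul]

theorem transition_exclusionRate (hf : IsProbability f) (k : ℕ) (t : ℝ)
    (h : {A : Finset V // A.card = k} → ℝ) :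
    (transition (exclusionRate k f) t).mulVec h = heat (ringGen f (setAct k)) t h := by
  rw [transition_mulVec, generator_exclusionRate hf]

end Exclusion

/-! ### Oscillation and mixing -/

section Oscillation

variable {X : Type*} [Fintype X]

/-- `exp (t A)` contracts the oscillation of functions by the factor `ρ`. -/
def OscContracts (A : (X → ℝ) →ₗ[ℝ] (X → ℝ)) (t ρ : ℝ) : Prop :=
  ∀ (h : X → ℝ) (m M : ℝ), (∀ x, m ≤ h x ∧ h x ≤ M) →
    ∀ x y, heat A t h x - heat A t h y ≤ ρ * (M - m)

variable {A : (X → ℝ) →ₗ[ℝ] (X → ℝ)}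

theorem oscContracts_of_unit (h1 : A 1 = 0) {t ρ : ℝ}
    (H : ∀ h : X → ℝ, (∀ x, 0 ≤ h x ∧ h x ≤ 1) → ∀ x y, heat A t h x - heat A t h y ≤ ρ) :
    OscContracts A t ρ := by
  intro h m M hm x y
  rcases (show m ≤ M from (hm x).1.trans (hm x).2).eq_or_lt with rfl | hlt
  · have : h = fun _ => m := funext fun x => le_antisymm (hm x).2 (hm x).1
    rw [this, heat_const h1]
    simp
  · have hpos : 0 < M - m := sub_pos.2 hlt
    have h2 := H (fun x => (M - m)⁻¹ * (h x - m)) (fun x => ⟨mul_nonneg (inv_nonneg.2 hpos.le)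
      (sub_nonneg.2 (hm x).1), ?_⟩) x y
    · have h3 : (fun x => (M - m)⁻¹ * (h x - m)) = (M - m)⁻¹ • (h - fun _ => m) := by ext; simp
      rw [h3, heat_smul_fun, heat_sub_fun, heat_const h1] at h2
      simp only [Pi.smul_apply, Pi.sub_apply, smul_eq_mul] at h2
      rw [← mul_sub, sub_sub_sub_cancel_right, inv_mul_le_iff₀ hpos] at h2
      linarith
    · rw [inv_mul_le_iff₀ hpos]
      linarith [(hm x).2]

theorem OscContracts.add {s t ρ ρ' : ℝ} (hs : OscContracts A s ρ) (ht : OscContracts A t ρ') :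
    OscContracts A (s + t) (ρ * ρ') := by
  intro h m M hm x y
  have : Nonempty X := ⟨x⟩
  obtain ⟨a, ha⟩ := Finite.exists_min (heat A t h)
  have h1 := hs (heat A t h) (heat A t h a) (heat A t h a + ρ' * (M - m))
    (fun z => ⟨ha z, by linarith [ht h m M hm z a]⟩) x y
  rw [heat_add, mul_assoc]
  linarith

/-- The oscillation does not increase. -/
theorem oscContracts_one (hA : QuasiPositive A) (h1 : A 1 = 0) {t : ℝ} (ht : 0 ≤ t) :
    OscContracts A t 1 := by
  intro h m M hm x y
  have h2 := heat_mono hA ht (u := fun _ => m) (v := h) (fun z => (hm z).1) y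
  have h3 := heat_mono hA ht (u := h) (v := fun _ => M) (fun z => (hm z).2) x
  rw [heat_const h1] at h2 h3
  linarith

theorem OscContracts.nsmul {t ρ : ℝ} (ht : OscContracts A t ρ) (k : ℕ) :
    OscContracts A (k * t) (ρ ^ k) := by
  induction k with
  | zero =>
    intro h m M hm x y
    simp only [Nat.cast_zero, zero_mul, heat_zero, pow_zero, one_mul]
    linarith [(hm x).2, (hm y).1]
  | succ k ih =>
    have := ih.add ht
    rwa [← pow_succ, show (k : ℝ) * t + t = ((k + 1 : ℕ) : ℝ) * t by push_cast; ring] at this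

theorem OscContracts.mono {t ρ ρ' : ℝ} (ht : OscContracts A t ρ) (hρ : ρ ≤ ρ') :
    OscContracts A t ρ' := fun h m M hm x y =>
  (ht h m M hm x y).trans (mul_le_mul_of_nonneg_right hρ
    (sub_nonneg.2 ((hm x).1.trans (hm x).2)))

theorem sum_sub_le_tvDist [DecidableEq X] {μ ν : X → ℝ} {ε : ℝ} (h : tvDist μ ν ≤ ε)
    {u : X → ℝ} (hu : ∀ x, 0 ≤ u x ∧ u x ≤ 1) : ∑ x, (μ x - ν x) * u x ≤ ε := by
  classical
  have h1 : ∑ x ∈ Finset.univ.filter (fun x => 0 ≤ μ x - ν x), (μ x - ν x) ≤ tvDist μ ν := by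
    rw [Finset.sum_sub_distrib]
    exact le_ciSup (f := fun A : Finset X => ∑ x ∈ A, μ x - ∑ x ∈ A, ν x)
      (Set.finite_range _).bddAbove _
  refine le_trans ?_ (h1.trans h)
  rw [Finset.sum_filter]
  refine Finset.sum_le_sum fun x _ => ?_
  split_ifs with hx
  · exact mul_le_of_le_one_right hx (hu x).2
  · exact mul_nonpos_of_nonpos_of_nonneg (not_le.1 hx).le (hu x).1

end Oscillation

section Mixing

variable {V : Type*} [DecidableEq V] [Fintype V] {E : Finset (Finset V)} {f : EdgeWeights E}

/-- If the semigroup of the exclusion process has oscillation at most `ε` at time `t`, then the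
process is within `ε` of every equilibrium distribution. -/
theorem exclusionMixingTime_le (hf : IsProbability f) {k : ℕ} {ε : ℝ} (t : ℝ≥0)
    (ht : OscContracts (ringGen f (setAct (V := V) k)) t ε) :
    exclusionMixingTime k f ε ≤ (t : ℝ≥0∞) := by
  refine iInf₂_le t fun p hp x => ?_
  refine ciSup_le fun A => ?_
  set h : {A : Finset V // A.card = k} → ℝ := fun y => if y ∈ A then 1 else 0 with hh
  have h1 : ∑ y ∈ A, transition (exclusionRate k f) t x y = heat (ringGen f (setAct k)) t h x := by
    rw [← transition_exclusionRate hf]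
    simp [Matrix.mulVec, dotProduct, hh]
  have h2 : ∑ y ∈ A, p y = ∑ z, p z * heat (ringGen f (setAct k)) t h z := by
    have h3 : ∑ y ∈ A, p y = p ⬝ᵥ h := by simp [dotProduct, hh]
    rw [h3, ← transition_exclusionRate hf]
    change _ = p ⬝ᵥ _
    rw [Matrix.dotProduct_mulVec, hp.invariant t t.2]
  have h4 : heat (ringGen f (setAct k)) t h x
      = ∑ z, p z * heat (ringGen f (setAct k)) t h x := by
    rw [← Finset.sum_mul, hp.sum_eq_one, one_mul]
  rw [h1, h2, h4, ← Finset.sum_sub_distrib]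
  calc _ ≤ ∑ z, p z * ε := Finset.sum_le_sum fun z _ => by
        rw [← mul_sub]
        refine mul_le_mul_of_nonneg_left ?_ (hp.nonneg z)
        have := ht h 0 1 (fun y => by simp only [hh]; split_ifs <;> norm_num) x z
        linarith
    _ = ε := by rw [← Finset.sum_mul, hp.sum_eq_one, one_mul]

/-- The uniform distribution is an equilibrium distribution of the exclusion process. -/
theorem isEquilibrium_uniform (hf : IsProbability f) {k : ℕ}
    [Nonempty {A : Finset V // A.card = k}] :
    IsEquilibrium (exclusionRate k f)
      (fun _ => ((Fintype.card {A : Finset V // A.card = k} : ℝ))⁻¹) where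
  nonneg _ := by positivity
  sum_eq_one := by
    rw [Finset.sum_const, nsmul_eq_mul, Finset.card_univ]
    exact mul_inv_cancel₀ (Nat.cast_ne_zero.2 Fintype.card_ne_zero)
  invariant t _ := by
    set c := ((Fintype.card {A : Finset V // A.card = k} : ℝ))⁻¹
    ext B
    have h1 := sum_heat_ringGen hf (setAct_bijective (V := V) k) t (Pi.single B 1)
    rw [← transition_exclusionRate hf] at h1
    simp only [Matrix.mulVec_single_one, Finset.sum_pi_single', Finset.mem_univ, if_true,
      Matrix.col_apply] at h1
    simp [Matrix.vecMul, dotProduct, ← Finset.mul_sum, h1]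

theorem oscContracts_of_tvDist_le (hf : IsProbability f) {k : ℕ} {t : ℝ} {ε : ℝ}
    (H : ∀ p, IsEquilibrium (exclusionRate k f) p →
      ∀ x, tvDist (transition (exclusionRate k f) t x) p ≤ ε) :
    OscContracts (ringGen f (setAct (V := V) k)) t (2 * ε) := by
  refine oscContracts_of_unit (ringGen_one hf) fun h hh x y => ?_
  have : Nonempty {A : Finset V // A.card = k} := ⟨x⟩
  have hp := isEquilibrium_uniform hf (k := k) (V := V)
  set p := (fun _ : {A : Finset V // A.card = k} =>
    ((Fintype.card {A : Finset V // A.card = k} : ℝ))⁻¹)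
  have h1 := sum_sub_le_tvDist (H p hp x) hh
  have h2 := sum_sub_le_tvDist (H p hp y) (u := fun z => 1 - h z)
    (fun z => ⟨by linarith [(hh z).2], by linarith [(hh z).1]⟩)
  have h3 : ∑ z, transition (exclusionRate k f) t y z = 1 := by
    have := congrFun (transition_exclusionRate hf k t 1) y
    rw [heat_eq_self _ (ringGen_one hf)] at this
    simpa [Matrix.mulVec, dotProduct] using this
  rw [← transition_exclusionRate hf]
  simp only [Matrix.mulVec, dotProduct]
  simp only [sub_mul, mul_sub, mul_one, Finset.sum_sub_distrib, h3, hp.sum_eq_one] at h1 h2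
  linarith

end Mixing

/-! ### One and two labelled particles -/

section Labelled

variable {V : Type*} [DecidableEq V] [Fintype V] {E : Finset (Finset V)} {f : EdgeWeights E}

/-- The action of permutations on vertices. -/
def vertexAct (g : Equiv.Perm V) (v : V) : V := g v

/-- The action of permutations on ordered pairs of vertices. -/
def pairAct (g : Equiv.Perm V) (p : V × V) : V × V := (g p.1, g p.2)

theorem oscContracts_vertexAct (hf : IsProbability f) {t ρ : ℝ} (hV : 3 ≤ Fintype.card V)
    (ht : OscContracts (ringGen f (setAct (V := V) 2)) t ρ) :
    OscContracts (ringGen f vertexAct) t (2 * ρ) := by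
  refine oscContracts_of_unit (ringGen_one hf) fun u hu x y => ?_
  let T : (V → ℝ) →ₗ[ℝ] ({A : Finset V // A.card = 2} → ℝ) :=
    LinearMap.pi fun A => ∑ a ∈ A.1, LinearMap.proj a
  have hT : ∀ v A, T v A = ∑ a ∈ A.1, v a := fun v A => by simp [T]
  have hTh := map_heat (ringGen f vertexAct) T (ringGen_intertwine (act' := setAct 2) T
    (fun g v A => by
      rw [hT, hT, setAct, Finset.sum_image (fun a _ b _ h => g.injective h)]; rfl)) t u
  have hbd : ∀ A, 0 ≤ T u A ∧ T u A ≤ 2 := fun A => by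
    rw [hT]
    refine ⟨Finset.sum_nonneg fun a _ => (hu a).1, ?_⟩
    refine (Finset.sum_le_card_nsmul A.1 _ 1 fun a _ => (hu a).2).trans ?_
    rw [A.2]; norm_num
  obtain ⟨z, hz⟩ : ∃ z, z ∉ ({x, y} : Finset V) := by
    by_contra! h
    have := Finset.card_le_two (a := x) (b := y)
    rw [Finset.eq_univ_iff_forall.2 h, Finset.card_univ] at this
    omega
  simp only [Finset.mem_insert, Finset.mem_singleton, not_or] at hz
  have h := ht (T u) 0 2 hbd ⟨{x, z}, Finset.card_pair (Ne.symm hz.1)⟩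
    ⟨{y, z}, Finset.card_pair (Ne.symm hz.2)⟩
  rw [← hTh, hT, hT] at h
  simp only [Finset.sum_pair (Ne.symm hz.1), Finset.sum_pair (Ne.symm hz.2)] at h
  linarith

theorem abs_heat_sub_mean_le {X : Type*} [Fintype X] {A : (X → ℝ) →ₗ[ℝ] (X → ℝ)} {t ρ : ℝ}
    (ht : OscContracts A t ρ) {u : X → ℝ} (hsum : ∑ x, heat A t u x = ∑ x, u x) {m M : ℝ}
    (hu : ∀ x, m ≤ u x ∧ u x ≤ M) (x : X) :
    |heat A t u x - (∑ y, u y) / Fintype.card X| ≤ ρ * (M - m) := by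
  have : Nonempty X := ⟨x⟩
  have hc : (0 : ℝ) < Fintype.card X := by exact_mod_cast Fintype.card_pos
  have h1 : heat A t u x - (∑ y, u y) / Fintype.card X
      = (∑ y, (heat A t u x - heat A t u y)) / Fintype.card X := by
    rw [Finset.sum_sub_distrib, hsum]
    simp only [Finset.sum_const, Finset.card_univ, nsmul_eq_mul]
    field_simp
  have h2 : ∀ y, |heat A t u x - heat A t u y| ≤ ρ * (M - m) := fun y =>
    abs_le.2 ⟨by linarith [ht u m M hu y x], ht u m M hu x y⟩
  rw [h1, abs_div, abs_of_pos hc, div_le_iff₀ hc]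
  refine (Finset.abs_sum_le_sum_abs _ _).trans ((Finset.sum_le_sum fun y _ => h2 y).trans ?_)
  simp [mul_comm]

/-- The mean of a function of an ordered pair over the pairs of distinct vertices. -/
def pairMean (φ : V × V → ℝ) : ℝ :=
  (∑ p ∈ (Finset.univ : Finset V).offDiag, φ p) / (Fintype.card V * (Fintype.card V - 1))

theorem sum_sum_offDiag (φ : V × V → ℝ) :
    ∑ A : {A : Finset V // A.card = 2}, ∑ p ∈ A.1.offDiag, φ p
      = ∑ p ∈ (Finset.univ : Finset V).offDiag, φ p := by
  rw [Finset.sum_comm' (s' := fun p => Finset.univ.filter fun A => p ∈ A.1.offDiag)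
    (t' := Finset.univ.offDiag)]
  · refine Finset.sum_congr rfl fun p hp => ?_
    have hne : p.1 ≠ p.2 := by simpa using hp
    have : (Finset.univ.filter fun A : {A : Finset V // A.card = 2} => p ∈ A.1.offDiag)
        = {⟨{p.1, p.2}, Finset.card_pair hne⟩} := by
      ext A
      simp only [Finset.mem_filter, Finset.mem_univ, true_and, Finset.mem_offDiag,
        Finset.mem_singleton]
      constructor
      · rintro ⟨h1, h2, -⟩
        refine Subtype.ext (Finset.eq_of_subset_of_card_le ?_ ?_).symm
        · exact Finset.insert_subset h1 (Finset.singleton_subset_iff.2 h2)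
        · rw [A.2, Finset.card_pair hne]
      · rintro rfl
        simp [hne]
    rw [this, Finset.sum_singleton]
  · intro A p
    simp only [Finset.mem_univ, true_and, Finset.mem_offDiag, Finset.mem_filter]
    tauto

/-- Mixing of the two-particle exclusion process controls a labelled pair of particles after
symmetrization. -/
theorem abs_heat_pair_le (hf : IsProbability f) {t ρ : ℝ}
    (ht : OscContracts (ringGen f (setAct (V := V) 2)) t ρ) {φ : V × V → ℝ} {M : ℝ}
    (hφ : ∀ p, 0 ≤ φ p ∧ φ p ≤ M) {x y : V} (hxy : x ≠ y) :
    |heat (ringGen f pairAct) t φ (x, y) + heat (ringGen f pairAct) t φ (y, x) - 2 * pairMean φ|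
      ≤ 2 * ρ * M := by
  let T : (V × V → ℝ) →ₗ[ℝ] ({A : Finset V // A.card = 2} → ℝ) :=
    LinearMap.pi fun A => ∑ p ∈ A.1.offDiag, LinearMap.proj p
  have hT : ∀ v A, T v A = ∑ p ∈ A.1.offDiag, v p := fun v A => by simp [T]
  have hTh := map_heat (ringGen f pairAct) T (ringGen_intertwine (act' := setAct 2) T
    (fun g v A => by
      rw [hT, hT]
      refine Finset.sum_bij (fun p _ => pairAct g p) ?_ ?_ ?_ ?_
      · intro p hp
        simp only [setAct, pairAct, Finset.mem_offDiag, Finset.mem_image] at hp ⊢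
        exact ⟨⟨_, hp.1, rfl⟩, ⟨_, hp.2.1, rfl⟩, fun h => hp.2.2 (g.injective h)⟩
      · intro p _ q _ h
        simp only [pairAct, Prod.mk.injEq, EmbeddingLike.apply_eq_iff_eq] at h
        exact Prod.ext h.1 h.2
      · rintro ⟨p, q⟩ hp
        simp only [setAct, Finset.mem_offDiag, Finset.mem_image] at hp
        obtain ⟨⟨a, ha, rfl⟩, ⟨b, hb, rfl⟩, hab⟩ := hp
        refine ⟨(a, b), ?_, rfl⟩
        simp only [Finset.mem_offDiag, ha, hb, true_and]
        rintro rfl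
        exact hab rfl
      · intros; rfl)) t φ
  have hbd : ∀ A, 0 ≤ T φ A ∧ T φ A ≤ 2 * M := fun A => by
    rw [hT]
    refine ⟨Finset.sum_nonneg fun a _ => (hφ a).1, ?_⟩
    refine (Finset.sum_le_card_nsmul A.1.offDiag _ M fun a _ => (hφ a).2).trans ?_
    rw [Finset.offDiag_card, A.2]; norm_num
  have h := abs_heat_sub_mean_le ht (u := T φ) (sum_heat_ringGen hf (setAct_bijective 2) t _) hbd
    ⟨{x, y}, Finset.card_pair hxy⟩
  have hmean : (∑ A, T φ A) / (Fintype.card {A : Finset V // A.card = 2} : ℝ) = 2 * pairMean φ := by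
    simp only [hT]
    rw [sum_sum_offDiag, Fintype.card_finset_len, Nat.cast_choose_two, pairMean,
      div_div_eq_mul_div]
    ring
  have hoff : ({x, y} : Finset V).offDiag = {(x, y), (y, x)} := by
    ext ⟨a, b⟩
    simp only [Finset.mem_offDiag, Finset.mem_insert, Finset.mem_singleton, Prod.mk.injEq]
    constructor
    · rintro ⟨rfl | rfl, rfl | rfl, h⟩ <;> simp_all
    · rintro (⟨rfl, rfl⟩ | ⟨rfl, rfl⟩) <;> simp [hxy, Ne.symm hxy]
  rw [hmean, ← hTh, hT, hoff, Finset.sum_pair (by simp [hxy])] at h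
  linarith

theorem heat_pair_le (hf : IsProbability f) {t ρ : ℝ} (ht0 : 0 ≤ t)
    (ht : OscContracts (ringGen f (setAct (V := V) 2)) t ρ) {φ : V × V → ℝ} {M : ℝ}
    (hφ : ∀ p, 0 ≤ φ p ∧ φ p ≤ M) {x y : V} (hxy : x ≠ y) :
    heat (ringGen f pairAct) t φ (x, y) ≤ 2 * pairMean φ + 2 * ρ * M := by
  have h1 := (abs_le.1 (abs_heat_pair_le hf ht hφ hxy)).2
  have h2 := heat_nonneg (quasiPositive_ringGen (act := pairAct) hf) ht0
    (u := φ) (fun p => (hφ p).1) (y, x)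
  simp only [Pi.zero_apply] at h2
  linarith

/-! ### Meetings of two particles -/

/-- Both particles of the pair are in the edge `e`. -/
def Meets (e : {e // e ∈ E}) (p : V × V) : Prop := p.1 ∈ e.1 ∧ p.2 ∈ e.1

instance (e : {e // e ∈ E}) (p : V × V) : Decidable (Meets e p) := by
  unfold Meets; infer_instance

/-- The probability that no edge containing both particles rings before time `t`. -/
def noMeet (f : EdgeWeights E) (t : ℝ) : V × V → ℝ := heat (killedGen f pairAct Meets 1) t 1

theorem noMeet_nonneg (hf : IsProbability f) {t : ℝ} (ht : 0 ≤ t) (p : V × V) :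
    0 ≤ noMeet f t p :=
  heat_nonneg (quasiPositive_killedGen hf Meets 1) ht (fun _ => zero_le_one) p

theorem noMeet_le_one (hf : IsProbability f) {t : ℝ} (ht : 0 ≤ t) (p : V × V) :
    noMeet f t p ≤ 1 :=
  heat_one_le (quasiPositive_killedGen hf Meets 1) (fun p => by
    rw [killedGen_one hf]
    exact Finset.sum_nonpos fun e _ => by split_ifs <;> norm_num) ht p

theorem noMeet_symm (t : ℝ) (x y : V) : noMeet f t (x, y) = noMeet f t (y, x) := by
  refine heat_comp (X := V × V) (Y := V × V) (φ := Prod.swap) (fun u => ?_) t 1 (y, x)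
  have hS : ∀ (e : {e // e ∈ E}) (p : V × V), Meets e p ↔ Meets e p.swap := fun e p => by
    simp only [Meets, Prod.fst_swap, Prod.snd_swap, and_comm]
  have hφ : ∀ (g : Equiv.Perm V) (p : V × V), Prod.swap (pairAct g p) = pairAct g (Prod.swap p) :=
    fun _ _ => rfl
  exact killedGen_comp hφ hS u

/-- After the pair has mixed, the probability of having met is bounded below in terms of that of a
uniform pair. -/
theorem noMeet_add_le (hf : IsProbability f) {s t ρ : ℝ} (hs : 0 ≤ s) (ht : 0 ≤ t)
    (hs' : OscContracts (ringGen f (setAct (V := V) 2)) s ρ) {x y : V} (hxy : x ≠ y) :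
    noMeet f (s + t) (x, y) ≤ 1 - pairMean (fun p => 1 - noMeet f t p) + ρ := by
  have h1 : noMeet f (s + t) (x, y) ≤ heat (ringGen f pairAct) s (noMeet f t) (x, y) := by
    rw [noMeet, heat_add]
    exact heat_le_heat (quasiPositive_killedGen hf Meets 1) (quasiPositive_ringGen hf)
      (fun u hu => killedGen_le_ringGen hf Meets le_rfl hu) hs (noMeet_nonneg hf ht) _
  have h2 := (abs_le.1 (abs_heat_pair_le hf hs' (φ := fun p => 1 - noMeet f t p) (M := 1)
    (fun p => ⟨by linarith [noMeet_le_one hf ht p], by linarith [noMeet_nonneg hf ht p]⟩) hxy)).1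
  have h3 : heat (ringGen f pairAct) s (fun p => 1 - noMeet f t p)
      = 1 - heat (ringGen f pairAct) s (noMeet f t) := by
    have : (fun p => 1 - noMeet f t p) = 1 - noMeet f t := rfl
    rw [this, heat_sub_fun, heat_eq_self _ (ringGen_one hf)]
  have h4 : heat (ringGen f pairAct) s (noMeet f t) (y, x)
      = heat (ringGen f pairAct) s (noMeet f t) (x, y) := by
    refine (heat_ringGen_comp (act' := pairAct) (φ := Prod.swap) (fun _ _ => rfl) s
      (noMeet f t) (x, y)).trans ?_
    have : noMeet f t ∘ Prod.swap = noMeet f t := by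
      funext ⟨a, b⟩
      exact noMeet_symm t b a
    rw [this]
  rw [h3] at h2
  simp only [Pi.sub_apply, Pi.one_apply, h4] at h2
  linarith

/-- Multiplication by the indicator of the pairs of distinct vertices. -/
def distinctMul : (V × V → ℝ) →ₗ[ℝ] (V × V → ℝ) :=
  LinearMap.pi fun p => (if p.1 = p.2 then (0 : ℝ) else 1) • LinearMap.proj p

theorem distinctMul_apply (u : V × V → ℝ) (p : V × V) :
    distinctMul u p = (if p.1 = p.2 then (0 : ℝ) else 1) * u p := rfl

/-- Distinct particles stay distinct. -/
theorem distinctMul_killedGen (u : V × V → ℝ) :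
    distinctMul (killedGen f pairAct Meets 1 u) = killedGen f pairAct Meets 1 (distinctMul u) := by
  refine jumpOp_intertwine distinctMul (fun e σ u p => ?_) (fun e u p => ?_) u
  · simp only [distinctMul_apply, pairAct, EmbeddingLike.apply_eq_iff_eq]
    ring
  · simp only [distinctMul_apply]
    ring

theorem noMeet_nsmul_le (hf : IsProbability f) {t q : ℝ} (ht : 0 ≤ t)
    (hq : ∀ x y : V, x ≠ y → noMeet f t (x, y) ≤ q) (hq0 : 0 ≤ q) (k : ℕ) {x y : V} (hxy : x ≠ y) :
    noMeet f (k * t) (x, y) ≤ q ^ k := by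
  have hK := quasiPositive_killedGen (act := pairAct) hf (Meets (E := E) (V := V)) 1
  induction k with
  | zero => simp [noMeet]
  | succ k ih =>
    have h1 : noMeet f ((k + 1 : ℕ) * t) (x, y)
        = heat (killedGen f pairAct Meets 1) (k * t) (distinctMul (noMeet f t)) (x, y) := by
      rw [← map_heat _ distinctMul distinctMul_killedGen, distinctMul_apply, if_neg hxy, one_mul,
        noMeet, noMeet, ← heat_add]
      congr 2
      push_cast; ring
    have h2 : distinctMul (noMeet f t) ≤ q • 1 := by
      rintro ⟨a, b⟩
      rw [distinctMul_apply]
      split_ifs with hab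
      · simpa using hq0
      · simpa using hq a b hab
    rw [h1]
    refine (heat_mono hK (by positivity) h2 (x, y)).trans ?_
    rw [heat_smul_fun, pow_succ, mul_comm (q ^ k)]
    exact mul_le_mul_of_nonneg_left ih hq0

end Labelled

/-! ### Comparison with independent particles -/

section Semigroup

variable {X : Type*} [Fintype X]

theorem QuasiPositive.sum {ι : Type*} (s : Finset ι) {A : ι → (X → ℝ) →ₗ[ℝ] (X → ℝ)}
    (hA : ∀ i, QuasiPositive (A i)) : QuasiPositive (∑ i ∈ s, A i) := by
  choose κ hκ using hA
  refine ⟨∑ i ∈ s, κ i, fun u hu => ?_⟩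
  rw [LinearMap.sum_apply, Finset.sum_smul, ← Finset.sum_add_distrib]
  exact Finset.sum_nonneg fun i _ => hκ i u hu

/-- The semigroup of a sum of commuting generators is the product of their semigroups. -/
theorem heat_add_of_commute {A B : (X → ℝ) →ₗ[ℝ] (X → ℝ)} (h : ∀ u, A (B u) = B (A u)) (t : ℝ)
    (u : X → ℝ) : heat (A + B) t u = heat A t (heat B t u) := by
  have h1 := eq_heat (A + B) (y := fun s => heat A s (heat B s u)) (fun s => ?_) t
  · simpa using h1.symm
  · have h2 := ((hasDerivAt_exp_smul_const' A.toContinuousLinearMap s).clm_apply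
      (hasDerivAt_heat B s u))
    refine h2.congr_deriv ?_
    have h3 := map_heat A B (fun v => (h v).symm) s (heat B s u)
    rw [LinearMap.add_apply, h3]
    simp [heat]

/-- Two conservative positive semigroups that both dominate the same killed semigroup differ by at
most the probability of being killed. -/
theorem abs_heat_sub_heat_le {A B K : (X → ℝ) →ₗ[ℝ] (X → ℝ)} (hA : QuasiPositive A)
    (hB : QuasiPositive B) (hK : QuasiPositive K) (hA1 : A 1 = 0) (hB1 : B 1 = 0)
    (hKA : ∀ u, 0 ≤ u → K u ≤ A u) (hKB : ∀ u, 0 ≤ u → K u ≤ B u) {t : ℝ} (ht : 0 ≤ t)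
    {u : X → ℝ} (hu : ∀ x, 0 ≤ u x ∧ u x ≤ 1) (x : X) :
    |heat A t u x - heat B t u x| ≤ 1 - heat K t 1 x := by
  have key : ∀ C : (X → ℝ) →ₗ[ℝ] (X → ℝ), QuasiPositive C → C 1 = 0 →
      (∀ u, 0 ≤ u → K u ≤ C u) →
      heat K t u x ≤ heat C t u x ∧ heat C t u x ≤ heat K t u x + (1 - heat K t 1 x) := by
    intro C hC hC1 hKC
    refine ⟨heat_le_heat hK hC hKC ht (fun y => (hu y).1) x, ?_⟩
    have h := heat_le_heat hK hC hKC ht (u := 1 - u) (fun y => sub_nonneg.2 (hu y).2) x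
    rw [heat_sub_fun, heat_sub_fun, heat_eq_self C hC1] at h
    simp only [Pi.sub_apply, Pi.one_apply] at h
    linarith
  have h1 := key A hA hA1 hKA
  have h2 := key B hB hB1 hKB
  exact abs_le.2 ⟨by linarith, by linarith⟩

end Semigroup

section Tuples

variable {V : Type*} [DecidableEq V] {E : Finset (Finset V)} {f : EdgeWeights E} {k : ℕ}

/-- The action of permutations on tuples of vertices. -/
def tupleAct (g : Equiv.Perm V) (x : Fin k → V) : Fin k → V := fun i => g (x i)

/-- A permutation moves the `i`-th entry of a tuple and leaves the others. -/
def coordAct (i : Fin k) (g : Equiv.Perm V) (x : Fin k → V) : Fin k → V :=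
  Function.update x i (g (x i))

theorem coordAct_comm {i j : Fin k} (hij : i ≠ j) (g g' : Equiv.Perm V) (x : Fin k → V) :
    coordAct i g (coordAct j g' x) = coordAct j g' (coordAct i g x) := by
  simp only [coordAct, Function.update_of_ne hij, Function.update_of_ne hij.symm]
  exact Function.update_comm hij.symm _ _ _

theorem extend_apply_of_notMem {e : Finset V} (σ : Equiv.Perm {v // v ∈ e}) {v : V} (hv : v ∉ e) :
    extend σ v = v :=
  Equiv.Perm.ofSubtype_apply_of_not_mem σ hv

variable [Fintype V]

theorem heat_coordAct (i : Fin k) (t : ℝ) (u : (Fin k → V) → ℝ) (x : Fin k → V) :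
    heat (ringGen f (coordAct i)) t u x
      = heat (ringGen f vertexAct) t (u ∘ Function.update x i) (x i) := by
  have hφ : ∀ (g : Equiv.Perm V) (a : V), Function.update x i (vertexAct g a)
      = coordAct i g (Function.update x i a) := fun g a => by simp [coordAct, vertexAct]
  rw [← heat_ringGen_comp hφ, Function.update_eq_self]

theorem coordGen_comm {i j : Fin k} (hij : i ≠ j) (u : (Fin k → V) → ℝ) :
    ringGen f (coordAct i) (ringGen f (coordAct j) u)
      = ringGen f (coordAct j) (ringGen f (coordAct i) u) := by
  refine (ringGen_intertwine (act := coordAct j) (act' := coordAct j) (ringGen f (coordAct i))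
    (fun g v y => ?_) u)
  exact (congrFun (jumpOp_comp (f := f) (act := coordAct i) (act' := coordAct i)
    (w := fun _ _ _ => 1) (b := fun _ _ => 1) (w' := fun _ _ _ => 1) (b' := fun _ _ => 1)
    (φ := coordAct j g) (fun g' z => coordAct_comm hij.symm _ _ _) (fun _ _ _ => rfl)
    (fun _ _ => rfl) v) y).symm

/-- Independent particles forget their starting points one coordinate at a time. -/
theorem heat_coord_sum_sub_le (hf : IsProbability f) {t ρ : ℝ} (ht0 : 0 ≤ t)
    (ht : OscContracts (ringGen f (vertexAct (V := V))) t ρ) {u : (Fin k → V) → ℝ}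
    (hu : ∀ x, 0 ≤ u x ∧ u x ≤ 1) (s : Finset (Fin k)) :
    ∀ x y : Fin k → V, (∀ i, i ∉ s → x i = y i) →
      heat (∑ i ∈ s, ringGen f (coordAct i)) t u x - heat (∑ i ∈ s, ringGen f (coordAct i)) t u y
        ≤ s.card * ρ := by
  induction s using Finset.induction_on with
  | empty =>
    intro x y hxy
    have : x = y := funext fun i => hxy i (by simp)
    simp [this]
  | insert j s hj ih =>
    intro x y hxy
    set v := heat (∑ i ∈ s, ringGen f (coordAct i)) t u with hv
    have hQ : QuasiPositive (∑ i ∈ s, ringGen f (coordAct (V := V) i)) :=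
      QuasiPositive.sum s fun i => quasiPositive_ringGen hf
    have hv01 : ∀ z, 0 ≤ v z ∧ v z ≤ 1 := fun z => by
      refine ⟨heat_nonneg hQ ht0 (fun y => (hu y).1) z, ?_⟩
      refine (heat_mono hQ ht0 (v := 1) (fun y => (hu y).2) z).trans ?_
      rw [heat_eq_self _ (by simp [LinearMap.sum_apply, ringGen_one hf])]
      rfl
    have hstep : heat (∑ i ∈ insert j s, ringGen f (coordAct i)) t u
        = heat (ringGen f (coordAct j)) t v := by
      rw [Finset.sum_insert hj, heat_add_of_commute]
      intro w
      simp only [LinearMap.sum_apply, map_sum]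
      refine Finset.sum_congr rfl fun i hi => ?_
      exact coordGen_comm (by rintro rfl; exact hj hi) w
    rw [hstep]
    set x' := Function.update x j (y j) with hx'
    have h1 : heat (ringGen f (coordAct j)) t v x - heat (ringGen f (coordAct j)) t v x' ≤ ρ := by
      have hup : Function.update x' j = Function.update x j := by ext a; simp [hx']
      rw [heat_coordAct, heat_coordAct, hup]
      have := ht (v ∘ Function.update x j) 0 1 (fun a => hv01 _) (x j) (x' j)
      linarith
    have h2 : heat (ringGen f (coordAct j)) t v x' ≤ heat (ringGen f (coordAct j)) t v y
        + s.card * ρ := by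
      rw [heat_coordAct, heat_coordAct]
      have hj' : x' j = y j := by simp [hx']
      have := heat_mono (quasiPositive_ringGen (act := vertexAct) hf) ht0
        (u := v ∘ Function.update x' j)
        (v := v ∘ Function.update y j + fun _ => (s.card * ρ : ℝ)) (fun a => ?_) (y j)
      · rw [heat_add_fun, heat_const (ringGen_one hf)] at this
        rw [hj']
        exact this
      · have := ih (Function.update x' j a) (Function.update y j a) (fun i hi => ?_)
        · simp only [Pi.add_apply, Function.comp_apply]
          linarith
        · by_cases hij : i = j
          · subst hij; simp
          · simp only [Function.update_of_ne hij, hx']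
            exact hxy i (by simp [hij, hi])
    rw [Finset.card_insert_of_notMem hj]
    push_cast
    linarith

/-- At least two entries of the tuple `x` are in the edge `e`. -/
def Crowded (e : {e // e ∈ E}) (x : Fin k → V) : Prop := ∃ i j, i < j ∧ Meets e (x i, x j)

instance (e : {e // e ∈ E}) (x : Fin k → V) : Decidable (Crowded e x) := by
  unfold Crowded; infer_instance

/-- An edge with at most one particle acts on the whole tuple as it acts on that particle alone. -/
theorem killedGen_crowded_le_sum (hf : IsProbability f) {u : (Fin k → V) → ℝ} (hu : 0 ≤ u) :
    killedGen f tupleAct Crowded k u ≤ (∑ i, ringGen f (coordAct i)) u := by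
  intro x
  rw [LinearMap.sum_apply, Finset.sum_apply]
  simp only [jumpOp_apply]
  rw [Finset.sum_comm]
  refine Finset.sum_le_sum fun e _ => ?_
  by_cases hc : Crowded e x
  · simp only [hc, if_true, zero_mul, mul_zero, Finset.sum_const_zero, one_mul,
      Finset.sum_sub_distrib, Finset.sum_const, Finset.card_univ, Fintype.card_fin, nsmul_eq_mul]
    refine sub_le_sub_right (Finset.sum_nonneg fun i _ => Finset.sum_nonneg fun σ _ => ?_) _
    exact mul_nonneg ((hf e).1 σ) (hu _)
  · simp only [hc, if_false, one_mul]
    have hfix : ∀ i, x i ∉ e.1 → ∀ σ : Equiv.Perm {v // v ∈ e.1},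
        coordAct i (extend σ) x = x := fun i hi σ => by
      rw [coordAct, extend_apply_of_notMem σ hi, Function.update_eq_self]
    have hzero : ∀ i, x i ∉ e.1 →
        (∑ σ, f e σ * u (coordAct i (extend σ) x) - u x) = 0 := fun i hi => by
      simp only [hfix i hi, ← Finset.sum_mul, (hf e).2, one_mul, sub_self]
    by_cases h : ∃ j, x j ∈ e.1
    · obtain ⟨j, hj⟩ := h
      have hother : ∀ i, i ≠ j → x i ∉ e.1 := fun i hij hi => by
        rcases lt_or_gt_of_ne hij with h | h
        · exact hc ⟨i, j, h, hi, hj⟩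
        · exact hc ⟨j, i, h, hj, hi⟩
      rw [Finset.sum_eq_single j (fun i _ hij => hzero i (hother i hij)) (by simp)]
      refine sub_le_sub_right (Finset.sum_le_sum fun σ _ => ?_) _
      have : tupleAct (extend σ) x = coordAct j (extend σ) x := by
        ext i
        by_cases hij : i = j
        · subst hij; simp [tupleAct, coordAct]
        · rw [tupleAct, coordAct, Function.update_of_ne hij,
            extend_apply_of_notMem σ (hother i hij)]
      rw [this]
    · push Not at h
      rw [Finset.sum_eq_zero fun i _ => hzero i (h i)]
      have : ∀ σ : Equiv.Perm {v // v ∈ e.1}, tupleAct (extend σ) x = x := fun σ =>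
        funext fun i => extend_apply_of_notMem σ (h i)
      simp only [this, ← Finset.sum_mul, (hf e).2, one_mul, sub_self, le_refl]

/-- The probability that some two of the particles meet is controlled by the sum over the pairs
of the probabilities that the pair meets. -/
theorem one_sub_heat_crowded_le (hf : IsProbability f) (hk : 1 ≤ k) {t : ℝ} (ht : 0 ≤ t)
    (x : Fin k → V) :
    1 - heat (killedGen f tupleAct Crowded k) t 1 x
      ≤ k * ∑ p : Fin k × Fin k with p.1 < p.2, (1 - noMeet f t (x p.1, x p.2)) := by
  have hk' : (1 : ℝ) ≤ k := by exact_mod_cast hk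
  let T : (V × V → ℝ) →ₗ[ℝ] ((Fin k → V) → ℝ) :=
    ∑ p : Fin k × Fin k with p.1 < p.2, LinearMap.funLeft ℝ ℝ fun x => (x p.1, x p.2)
  have hT : ∀ u x, T u x = ∑ p : Fin k × Fin k with p.1 < p.2, u (x p.1, x p.2) := fun u x => by
    simp [T, LinearMap.sum_apply, LinearMap.funLeft_apply]
  have hn : ∀ s, HasDerivAt (fun s => 1 - noMeet f s) (- killedGen f pairAct Meets 1 (noMeet f s)) s :=
    fun s => (hasDerivAt_heat (killedGen f pairAct Meets 1) s 1).const_sub (1 : V × V → ℝ)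
  have h := nonneg_of_supersolution (quasiPositive_killedGen (act := tupleAct) hf
      (Crowded (E := E) (V := V) (k := k)) k)
    (y := fun s => heat (killedGen f tupleAct Crowded k) s 1 - 1 + (k : ℝ) • T (1 - noMeet f s))
    (y' := fun s => killedGen f tupleAct Crowded k (heat (killedGen f tupleAct Crowded k) s 1)
      + (k : ℝ) • T (- killedGen f pairAct Meets 1 (noMeet f s)))
    (fun s => ?_) (fun s hs => ?_) (by simp [noMeet]) ht
  · have := h x
    simp only [Pi.zero_apply, Pi.add_apply, Pi.sub_apply, Pi.one_apply, Pi.smul_apply, hT,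
      smul_eq_mul] at this
    linarith
  · exact ((hasDerivAt_heat _ s 1).sub_const 1).add
      ((T.toContinuousLinearMap.hasFDerivAt.comp_hasDerivAt s (hn s)).const_smul (k : ℝ))
  · set n := noMeet f s with hn
    have hn0 : ∀ p, 0 ≤ n p := noMeet_nonneg hf hs
    have hn1 : ∀ p, n p ≤ 1 := noMeet_le_one hf hs
    rw [map_add, map_sub, map_smul]
    intro x
    simp only [Pi.add_apply, Pi.sub_apply, Pi.smul_apply, smul_eq_mul, killedGen_one hf]
    suffices H : (∑ e : {e // e ∈ E}, if Crowded e x then (1 : ℝ) else 0)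
        + killedGen f tupleAct Crowded k (T (1 - n)) x
        ≤ T (- killedGen f pairAct Meets 1 n) x by
      have h1 : (∑ e : {e // e ∈ E}, if Crowded e x then (-k : ℝ) else 0)
          = - (k * ∑ e : {e // e ∈ E}, if Crowded e x then (1 : ℝ) else 0) := by
        rw [Finset.mul_sum, ← Finset.sum_neg_distrib]
        exact Finset.sum_congr rfl fun e _ => by split_ifs <;> simp
      have h2 := mul_le_mul_of_nonneg_left H (zero_le_one.trans hk')
      rw [h1]
      linarith
    rw [hT]
    simp only [Pi.neg_apply, jumpOp_apply]
    simp only [hT, Finset.mul_sum, ← Finset.sum_neg_distrib]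
    rw [Finset.sum_comm (s := Finset.univ.filter _), ← Finset.sum_add_distrib]
    refine Finset.sum_le_sum fun e _ => ?_
    by_cases hc : Crowded e x
    · simp only [hc, if_true, zero_mul, mul_zero, Finset.sum_const_zero, zero_sub]
      obtain ⟨i, j, hij, hm⟩ := hc
      have hterm : ∀ p : Fin k × Fin k, (if Meets e (x p.1, x p.2) then (1 : ℝ) else 0)
          - k * (1 - n (x p.1, x p.2)) ≤ -(∑ σ, f e σ * ((if Meets e (x p.1, x p.2) then 0 else 1)
            * n (pairAct (extend σ) (x p.1, x p.2)))
            - (if Meets e (x p.1, x p.2) then 1 else 1) * n (x p.1, x p.2)) := by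
        intro p
        have h3 : (1 - n (x p.1, x p.2)) ≤ k * (1 - n (x p.1, x p.2)) :=
          le_mul_of_one_le_left (sub_nonneg.2 (hn1 _)) hk'
        split_ifs with hmp
        · simp only [zero_mul, mul_zero, Finset.sum_const_zero]
          linarith
        · have h4 : ∑ σ, f e σ * (1 * n (pairAct (extend σ) (x p.1, x p.2))) ≤ 1 := by
            refine (Finset.sum_le_sum fun σ _ => mul_le_of_le_one_right ((hf e).1 σ)
              ((one_mul _).trans_le (hn1 _))).trans_eq (hf e).2
          linarith
      have h5 : (1 : ℝ) ≤ ∑ p : Fin k × Fin k with p.1 < p.2,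
          if Meets e (x p.1, x p.2) then (1 : ℝ) else 0 := by
        have := Finset.single_le_sum (s := Finset.univ.filter fun p : Fin k × Fin k => p.1 < p.2)
          (f := fun p => if Meets e (x p.1, x p.2) then (1 : ℝ) else 0)
          (fun p _ => by split_ifs <;> norm_num) (a := (i, j)) (by simpa using hij)
        simpa [hm] using this
      refine le_trans ?_ (Finset.sum_le_sum fun p _ => hterm p)
      rw [Finset.sum_sub_distrib]
      simp only [Pi.sub_apply, Pi.one_apply]
      linarith
    · have hm : ∀ p : Fin k × Fin k, p.1 < p.2 → ¬ Meets e (x p.1, x p.2) :=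
        fun p hp hm => hc ⟨p.1, p.2, hp, hm⟩
      simp only [hc, if_false, zero_add, one_mul]
      rw [Finset.sum_comm, ← Finset.sum_sub_distrib]
      refine Finset.sum_le_sum fun p hp => ?_
      simp only [hm p (by simpa using hp), if_false, one_mul, Pi.sub_apply, Pi.one_apply, mul_sub,
        mul_one, Finset.sum_sub_distrib, (hf e).2]
      refine le_of_eq ?_
      simp only [tupleAct, pairAct]
      ring

/-- If a uniform pair of particles is unlikely to meet, then particles that have mixed pairwise
behave like independent ones, and their positions forget the starting point. -/
theorem oscContracts_of_rarely_meet (hf : IsProbability f) (hV : 3 ≤ Fintype.card V) (hk : 1 ≤ k)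
    {t ρ δ : ℝ} (hρ : 0 ≤ ρ) (hδ0 : 0 ≤ δ)
    (ht0 : 0 ≤ t) (ht : OscContracts (ringGen f (setAct (V := V) 2)) t ρ)
    (hδ : pairMean (fun p => 1 - noMeet f t p) ≤ δ) :
    OscContracts (ringGen f (setAct (V := V) k)) (t + t)
      (2 * (k * (k * k * (2 * δ + 2 * ρ)) + k * (2 * ρ))) := by
  classical
  refine oscContracts_of_unit (ringGen_one hf) fun h hh A B => ?_
  let φ : {x : Fin k → V // Function.Injective x} → {A : Finset V // A.card = k} := fun x =>
    ⟨Finset.univ.image x.1, by rw [Finset.card_image_of_injective _ x.2]; simp⟩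
  let actI : Equiv.Perm V → {x : Fin k → V // Function.Injective x} →
    {x : Fin k → V // Function.Injective x} := fun g x => ⟨tupleAct g x.1, g.injective.comp x.2⟩
  have hφ : ∀ g x, φ (actI g x) = setAct k g (φ x) := fun g x => by
    refine Subtype.ext ?_
    simp only [φ, actI, setAct, Finset.image_image]
    rfl
  let u : (Fin k → V) → ℝ := fun x => if hx : Function.Injective x then h (φ ⟨x, hx⟩) else 0
  have hu : ∀ x, 0 ≤ u x ∧ u x ≤ 1 := fun x => by
    simp only [u]
    split_ifs
    · exact hh _
    · norm_num
  have hlift : ∀ s x, heat (ringGen f (setAct k)) s h (φ x)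
      = heat (ringGen f tupleAct) s u x.1 := fun s x => by
    rw [heat_ringGen_comp hφ, heat_ringGen_comp (act' := actI) (φ := Subtype.val)
      (fun _ _ => rfl)]
    congr 1
    funext y
    simp [u, y.2]
  have hsurj : ∀ A, ∃ x, φ x = A := fun A => by
    let q := A.1.equivFinOfCardEq A.2
    refine ⟨⟨fun i => (q.symm i).1, Subtype.val_injective.comp q.symm.injective⟩, ?_⟩
    refine Subtype.ext (Finset.ext fun v => ?_)
    simp only [φ, Finset.mem_image, Finset.mem_univ, true_and]
    constructor
    · rintro ⟨i, rfl⟩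
      exact (q.symm i).2
    · intro hv
      exact ⟨q ⟨v, hv⟩, by simp⟩
  obtain ⟨x, rfl⟩ := hsurj A
  obtain ⟨y, rfl⟩ := hsurj B
  rw [hlift, hlift]
  -- `κ` is the nearly constant value of the semigroup of independent particles.
  set I := ∑ i, ringGen f (coordAct (V := V) (k := k) i)
  set κ := heat I t u x.1
  have hv := oscContracts_vertexAct hf hV ht
  have hI : ∀ z, |heat I t u z - κ| ≤ k * (2 * ρ) := fun z => by
    have h1 := heat_coord_sum_sub_le hf ht0 hv hu Finset.univ z x.1 (by simp)
    have h2 := heat_coord_sum_sub_le hf ht0 hv hu Finset.univ x.1 z (by simp)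
    rw [Finset.card_univ, Fintype.card_fin] at h1 h2
    exact abs_le.2 ⟨by linarith, h1⟩
  have hQI : QuasiPositive I := QuasiPositive.sum _ fun i => quasiPositive_ringGen hf
  have hI1 : I 1 = 0 := by simp [I, LinearMap.sum_apply, ringGen_one hf]
  let b : (Fin k → V) → ℝ := (k : ℝ) • (∑ p : Fin k × Fin k with p.1 < p.2,
    (fun q => 1 - noMeet f t q) ∘ fun z : Fin k → V => (z p.1, z p.2)) + fun _ => k * (2 * ρ)
  have hnear : ∀ z,
      |(heat (ringGen f tupleAct) t u - (fun _ => κ : (Fin k → V) → ℝ)) z| ≤ b z := fun z => by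
    have h1 := abs_heat_sub_heat_le (quasiPositive_ringGen (act := tupleAct) hf) hQI
      (quasiPositive_killedGen hf Crowded k) (ringGen_one hf) hI1
      (fun u hu => killedGen_le_ringGen hf Crowded (by exact_mod_cast hk) hu)
      (fun u hu => killedGen_crowded_le_sum hf hu) ht0 hu z
    have h2 := one_sub_heat_crowded_le hf hk ht0 z
    have h3 := abs_sub_le (heat (ringGen f tupleAct) t u z) (heat I t u z) κ
    have h4 := hI z
    simp only [b, Pi.add_apply, Pi.smul_apply, Finset.sum_apply, Function.comp_apply, smul_eq_mul,
      Pi.sub_apply]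
    linarith
  have hfin : ∀ z : {x : Fin k → V // Function.Injective x},
      |heat (ringGen f tupleAct) (t + t) u z.1 - κ|
        ≤ k * (k * k * (2 * δ + 2 * ρ)) + k * (2 * ρ) := fun z => by
    have h1 := abs_heat_le (quasiPositive_ringGen (act := tupleAct) hf) ht0 hnear z.1
    rw [heat_sub_fun, heat_const (ringGen_one hf), ← heat_add, Pi.sub_apply] at h1
    refine h1.trans ?_
    simp only [b]
    rw [heat_add_fun, heat_smul_fun, heat_sum_fun, heat_const (ringGen_one hf)]
    simp only [Pi.add_apply, Pi.smul_apply, Finset.sum_apply, smul_eq_mul]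
    gcongr
    have h2 : ∀ p ∈ Finset.univ.filter fun p : Fin k × Fin k => p.1 < p.2,
        heat (ringGen f tupleAct) t ((fun q => 1 - noMeet f t q) ∘
          fun z : Fin k → V => (z p.1, z p.2)) z.1 ≤ 2 * δ + 2 * ρ := fun p hp => by
      rw [← heat_ringGen_comp (act := pairAct) (φ := fun z : Fin k → V => (z p.1, z p.2))
        (fun _ _ => rfl)]
      have hp : p.1 ≠ p.2 := by simpa using (Finset.mem_filter.1 hp).2.ne
      have := heat_pair_le hf ht0 ht (φ := fun q => 1 - noMeet f t q) (M := 1)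
        (fun q => ⟨by linarith [noMeet_le_one hf ht0 q], by linarith [noMeet_nonneg hf ht0 q]⟩)
        (x := z.1 p.1) (y := z.1 p.2) (fun h => hp (z.2 h))
      linarith
    refine (Finset.sum_le_card_nsmul _ _ _ h2).trans ?_
    have hpos : 0 ≤ 2 * δ + 2 * ρ := by positivity
    rw [nsmul_eq_mul]
    refine mul_le_mul_of_nonneg_right ?_ hpos
    have := Finset.card_filter_le (Finset.univ : Finset (Fin k × Fin k)) fun p => p.1 < p.2
    rw [Finset.card_univ, Fintype.card_prod, Fintype.card_fin] at this
    exact_mod_cast this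
  have h1 := abs_le.1 (hfin x)
  have h2 := abs_le.1 (hfin y)
  linarith

end Tuples

/-! ### Random permutations with a conjugation invariant law -/

section ClassFunction

variable {α : Type*} [Fintype α] [DecidableEq α] {w : Equiv.Perm α → ℝ}

omit [Fintype α] in
/-- A permutation mapping a given ordered pair to another one and moving nothing else. -/
theorem exists_perm_pair {a b c d : α} (hab : a ≠ b) (hcd : c ≠ d) :
    ∃ π : Equiv.Perm α, π a = c ∧ π b = d ∧
      ∀ x, x ≠ a → x ≠ b → x ≠ c → x ≠ d → π x = x := by
  have h1 : Equiv.swap a c b ≠ c := fun h =>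
    hab ((Equiv.swap a c).injective (h.trans (Equiv.swap_apply_left a c).symm)).symm
  refine ⟨Equiv.swap (Equiv.swap a c b) d * Equiv.swap a c, ?_, ?_, fun x h1 h2 h3 h4 => ?_⟩
  · rw [Equiv.Perm.mul_apply, Equiv.swap_apply_left, Equiv.swap_apply_of_ne_of_ne h1.symm hcd]
  · rw [Equiv.Perm.mul_apply, Equiv.swap_apply_left]
  · rw [Equiv.Perm.mul_apply, Equiv.swap_apply_of_ne_of_ne h1 h3]
    refine Equiv.swap_apply_of_ne_of_ne ?_ h4
    rw [Equiv.swap_apply_def]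
    split_ifs <;> assumption

theorem sum_filter_conj (hc : ∀ σ τ, IsConj σ τ → w σ = w τ) (π : Equiv.Perm α)
    (p q : Equiv.Perm α → Prop) [DecidablePred p] [DecidablePred q]
    (hpq : ∀ σ, p σ ↔ q (π * σ * π⁻¹)) : ∑ σ with p σ, w σ = ∑ σ with q σ, w σ := by
  refine Finset.sum_equiv (MulAut.conj π).toEquiv (fun σ => ?_) fun σ _ => ?_
  · simpa using hpq σ
  · exact hc _ _ (isConj_iff.2 ⟨π, rfl⟩)

theorem mul_sum_filter_apply_eq_le (hw0 : ∀ σ, 0 ≤ w σ) (hw1 : ∑ σ, w σ = 1)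
    (hc : ∀ σ τ, IsConj σ τ → w σ = w τ) {d z : α} (hdz : d ≠ z) :
    (Fintype.card α - 1 : ℝ) * ∑ σ with σ z = d, w σ ≤ 1 := by
  have h1 : ∀ y ∈ Finset.univ.erase z, ∑ σ with σ z = y, w σ = ∑ σ with σ z = d, w σ :=
    fun y hy => by
      have hyz : y ≠ z := (Finset.mem_erase.1 hy).1
      refine sum_filter_conj hc (Equiv.swap y d) _ _ fun σ => ?_
      simp only [Equiv.Perm.mul_apply, Equiv.swap_inv, Equiv.swap_apply_of_ne_of_ne hyz.symm hdz.symm]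
      rw [Equiv.swap_apply_eq_iff, Equiv.swap_apply_right]
  have h2 : ∑ y ∈ Finset.univ.erase z, ∑ σ with σ z = y, w σ ≤ 1 := by
    rw [← hw1]
    rw [Finset.sum_fiberwise_eq_sum_filter]
    exact Finset.sum_le_univ_sum_of_nonneg hw0
  rw [Finset.sum_congr rfl h1, Finset.sum_const, Finset.card_erase_of_mem (Finset.mem_univ z),
    Finset.card_univ, nsmul_eq_mul, Nat.cast_sub (Fintype.card_pos_iff.2 ⟨z⟩)] at h2
  simpa using h2

/-- The images of `d` and `z` under `σ` are both outside of `{d, z}`. -/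
def Escapes (d z : α) (σ : Equiv.Perm α) : Prop :=
  σ d ≠ d ∧ σ d ≠ z ∧ σ z ≠ d ∧ σ z ≠ z

instance (d z : α) (σ : Equiv.Perm α) : Decidable (Escapes d z σ) := by
  unfold Escapes; infer_instance

theorem one_sub_le_sum_escapes (hw0 : ∀ σ, 0 ≤ w σ) (hw1 : ∑ σ, w σ = 1) (d z : α) :
    1 - (∑ σ with σ d = d, w σ + ∑ σ with σ d = z, w σ + ∑ σ with σ z = d, w σ
      + ∑ σ with σ z = z, w σ) ≤ ∑ σ with Escapes d z σ, w σ := by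
  rw [← hw1]
  simp only [Finset.sum_filter, ← Finset.sum_add_distrib, ← Finset.sum_sub_distrib]
  refine Finset.sum_le_sum fun σ _ => ?_
  have hnn : ∀ (p : Prop) [Decidable p], 0 ≤ if p then w σ else 0 := fun p _ => by
    split_ifs; exacts [hw0 σ, le_rfl]
  have h1 := hnn (σ d = d)
  have h2 := hnn (σ d = z)
  have h3 := hnn (σ z = d)
  have h4 := hnn (σ z = z)
  by_cases hE : Escapes d z σ
  · rw [if_pos hE]
    linarith
  · rw [if_neg hE]
    have : σ d = d ∨ σ d = z ∨ σ z = d ∨ σ z = z := by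
      unfold Escapes at hE
      tauto
    rcases this with h | h | h | h
    · rw [if_pos h] at h1 ⊢; linarith
    · rw [if_pos h] at h2 ⊢; linarith
    · rw [if_pos h] at h3 ⊢; linarith
    · rw [if_pos h] at h4 ⊢; linarith

theorem sum_escapes_of_five_le (hw0 : ∀ σ, 0 ≤ w σ) (hw1 : ∑ σ, w σ = 1)
    (hc : ∀ σ τ, IsConj σ τ → w σ = w τ) (hfix : ∀ v, ∑ σ with σ v = v, w σ ≤ 1 / 5)
    (hα : 5 ≤ Fintype.card α) {d z : α} (hdz : d ≠ z) :
    1 / 10 ≤ ∑ σ with Escapes d z σ, w σ := by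
  have h1 := mul_sum_filter_apply_eq_le hw0 hw1 hc hdz
  have h2 := mul_sum_filter_apply_eq_le hw0 hw1 hc hdz.symm
  have h3 : (5 : ℝ) ≤ Fintype.card α := by exact_mod_cast hα
  have h4 : 0 ≤ ∑ σ with σ z = d, w σ := Finset.sum_nonneg fun σ _ => hw0 σ
  have h5 : 0 ≤ ∑ σ with σ d = z, w σ := Finset.sum_nonneg fun σ _ => hw0 σ
  have h6 := one_sub_le_sum_escapes hw0 hw1 d z
  have h7 := hfix d
  have h8 := hfix z
  nlinarith

theorem exists_escapes_of_derangement (hα : Fintype.card α = 4) (σ : Equiv.Perm α)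
    (hσ : ∀ i, σ i ≠ i) : ∃ u v, u ≠ v ∧ Escapes u v σ := by
  have hα' : 0 < Fintype.card α := by omega
  obtain ⟨u⟩ := Fintype.card_pos_iff.1 hα'
  by_cases h : σ (σ u) = u
  · obtain ⟨v, hv⟩ : ∃ v, v ∉ ({u, σ u} : Finset α) := by
      by_contra! h
      have := Finset.card_le_two (a := u) (b := σ u)
      rw [Finset.eq_univ_iff_forall.2 h, Finset.card_univ] at this
      omega
    simp only [Finset.mem_insert, Finset.mem_singleton, not_or] at hv
    refine ⟨u, v, Ne.symm hv.1, hσ u, Ne.symm hv.2, fun h' => hv.2 ?_, hσ v⟩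
    rw [← h] at h'
    exact σ.injective h'
  · refine ⟨u, σ (σ u), Ne.symm h, hσ u, Ne.symm (hσ _), fun h' => ?_, hσ _⟩
    -- otherwise `u` lies on a cycle of length three, which leaves a fourth, fixed point
    obtain ⟨v, hv⟩ : ∃ v, v ∉ ({u, σ u, σ (σ u)} : Finset α) := by
      by_contra! h
      have := Finset.card_le_three (a := u) (b := σ u) (c := σ (σ u))
      rw [Finset.eq_univ_iff_forall.2 h, Finset.card_univ] at this
      omega
    simp only [Finset.mem_insert, Finset.mem_singleton, not_or] at hv
    have h1 : σ v ∉ ({u, σ u, σ (σ u)} : Finset α) := by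
      simp only [Finset.mem_insert, Finset.mem_singleton, not_or]
      refine ⟨fun h2 => hv.2.2 (σ.injective (h2.trans h'.symm)), fun h2 => hv.1 (σ.injective h2),
        fun h2 => hv.2.1 (σ.injective h2)⟩
    have hcard : ({u, σ u, σ (σ u)} : Finset α).card = 3 :=
      Finset.card_eq_three.2 ⟨_, _, _, Ne.symm (hσ u), Ne.symm h, Ne.symm (hσ _), rfl⟩
    have h2 : ({σ v, v, u, σ u, σ (σ u)} : Finset α).card = 5 := by
      rw [Finset.card_insert_of_notMem, Finset.card_insert_of_notMem, hcard]
      · simpa using hv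
      · rw [Finset.mem_insert, not_or]
        exact ⟨hσ v, h1⟩
    have h3 := Finset.card_le_univ ({σ v, v, u, σ u, σ (σ u)} : Finset α)
    omega

theorem one_sub_le_sum_derangement (hw0 : ∀ σ, 0 ≤ w σ) (hw1 : ∑ σ, w σ = 1)
    (hfix : ∀ v, ∑ σ with σ v = v, w σ ≤ 1 / 5) :
    1 - Fintype.card α / 5 ≤ ∑ σ with ∀ i, σ i ≠ i, w σ := by
  have h1 : ∑ v, ∑ σ with σ v = v, w σ ≤ Fintype.card α / 5 := by
    refine (Finset.sum_le_card_nsmul _ _ _ fun v _ => hfix v).trans ?_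
    rw [Finset.card_univ, nsmul_eq_mul]
    linarith
  have h2 : 1 - ∑ σ with ∀ i, σ i ≠ i, w σ ≤ ∑ v, ∑ σ with σ v = v, w σ := by
    rw [← hw1]
    simp only [Finset.sum_filter]
    rw [Finset.sum_comm, ← Finset.sum_sub_distrib]
    refine Finset.sum_le_sum fun σ _ => ?_
    by_cases h : ∀ i, σ i ≠ i
    · simp [h]
    · rw [if_neg h]
      push Not at h
      obtain ⟨i, hi⟩ := h
      have := Finset.single_le_sum (f := fun v => if σ v = v then w σ else 0)
        (fun v _ => by split_ifs; exacts [hw0 σ, le_rfl]) (Finset.mem_univ i)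
      simpa [hi] using this
  linarith

theorem sum_escapes_of_card_eq_four (hw0 : ∀ σ, 0 ≤ w σ) (hw1 : ∑ σ, w σ = 1)
    (hc : ∀ σ τ, IsConj σ τ → w σ = w τ) (hfix : ∀ v, ∑ σ with σ v = v, w σ ≤ 1 / 5)
    (hα : Fintype.card α = 4) {d z : α} (hdz : d ≠ z) :
    1 / 60 ≤ ∑ σ with Escapes d z σ, w σ := by
  have h1 : ∀ p ∈ (Finset.univ : Finset α).offDiag,
      ∑ σ with Escapes p.1 p.2 σ, w σ = ∑ σ with Escapes d z σ, w σ := fun p hp => by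
    obtain ⟨π, hπ1, hπ2, -⟩ := exists_perm_pair (by simpa using hp) hdz
    refine sum_filter_conj hc π _ _ fun σ => ?_
    have h1 : π⁻¹ d = p.1 := by rw [← hπ1]; simp
    have h2 : π⁻¹ z = p.2 := by rw [← hπ2]; simp
    have h3 : ∀ x, π x = d ↔ x = p.1 := fun x => by rw [← hπ1, π.injective.eq_iff]
    have h4 : ∀ x, π x = z ↔ x = p.2 := fun x => by rw [← hπ2, π.injective.eq_iff]
    simp only [Escapes, Equiv.Perm.mul_apply, h1, h2, ne_eq, h3, h4]
  have h2 := one_sub_le_sum_derangement hw0 hw1 hfix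
  have h3 : ∑ σ with ∀ i, σ i ≠ i, w σ
      ≤ ∑ p ∈ (Finset.univ : Finset α).offDiag, ∑ σ with Escapes p.1 p.2 σ, w σ := by
    simp only [Finset.sum_filter]
    rw [Finset.sum_comm]
    refine Finset.sum_le_sum fun σ _ => ?_
    have hnn : ∀ p ∈ (Finset.univ : Finset α).offDiag,
      0 ≤ if Escapes p.1 p.2 σ then w σ else 0 := fun p _ => by split_ifs; exacts [hw0 σ, le_rfl]
    split_ifs with h
    · obtain ⟨u, v, huv, hesc⟩ := exists_escapes_of_derangement hα σ h
      have := Finset.single_le_sum hnn (a := (u, v)) (by simpa using huv)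
      simpa [hesc] using this
    · exact Finset.sum_nonneg hnn
  rw [Finset.sum_congr rfl h1, Finset.sum_const, Finset.offDiag_card, Finset.card_univ, hα,
    nsmul_eq_mul] at h3
  rw [hα] at h2
  norm_num at h2 h3
  linarith

/-- Given that the images of `d` and `z` escape, they form a uniform pair; so for any splitting
of at least three points into two classes they fall in the same class with probability at least
`1 / 4`. -/
theorem sum_escapes_le_same_class (hw0 : ∀ σ, 0 ≤ w σ) (hc : ∀ σ τ, IsConj σ τ → w σ = w τ)
    (hα : 5 ≤ Fintype.card α) {d z : α} (hdz : d ≠ z) (C : Finset α) :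
    ∑ σ with Escapes d z σ, w σ ≤ 4 * ∑ σ with Escapes d z σ ∧ (σ d ∈ C ↔ σ z ∈ C), w σ := by
  set O : Finset α := (Finset.univ.erase d).erase z
  have hmemO : ∀ x, x ∈ O ↔ x ≠ z ∧ x ≠ d := fun x => by simp [O]
  have hO : O.card + 2 = Fintype.card α := by
    rw [Finset.card_erase_of_mem (by simp [hdz.symm]), Finset.card_erase_of_mem (by simp),
      Finset.card_univ]
    omega
  obtain ⟨⟨x₀, y₀⟩, h₀⟩ : O.offDiag.Nonempty := by
    rw [← Finset.card_pos, Finset.offDiag_card]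
    have : 3 ≤ O.card := by omega
    have := Nat.mul_le_mul_right O.card this
    omega
  set q := ∑ σ with σ d = x₀ ∧ σ z = y₀, w σ
  have hq0 : 0 ≤ q := Finset.sum_nonneg fun σ _ => hw0 σ
  have hq : ∀ R ⊆ O.offDiag, ∑ σ with (σ d, σ z) ∈ R, w σ = R.card * q := by
    intro R hR
    rw [← Finset.sum_fiberwise_eq_sum_filter, Finset.sum_congr rfl (g := fun _ => q),
      Finset.sum_const, nsmul_eq_mul]
    rintro ⟨x, y⟩ hxy
    have hxy' := Finset.mem_offDiag.1 (hR hxy)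
    have h₀' := Finset.mem_offDiag.1 h₀
    obtain ⟨π, hπ1, hπ2, hπ⟩ := exists_perm_pair hxy'.2.2 h₀'.2.2
    simp only [hmemO] at hxy' h₀'
    have hd : π d = d := hπ d (Ne.symm hxy'.1.2) (Ne.symm hxy'.2.1.2) (Ne.symm h₀'.1.2)
      (Ne.symm h₀'.2.1.2)
    have hz : π z = z := hπ z (Ne.symm hxy'.1.1) (Ne.symm hxy'.2.1.1) (Ne.symm h₀'.1.1)
      (Ne.symm h₀'.2.1.1)
    have hd' : π⁻¹ d = d := by rw [Equiv.Perm.inv_eq_iff_eq, hd]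
    have hz' : π⁻¹ z = z := by rw [Equiv.Perm.inv_eq_iff_eq, hz]
    refine sum_filter_conj hc π _ _ fun σ => ?_
    dsimp only at hπ1 hπ2
    have h3 : ∀ v, π v = x₀ ↔ v = x := fun v => by rw [← hπ1, π.injective.eq_iff]
    have h4 : ∀ v, π v = y₀ ↔ v = y := fun v => by rw [← hπ2, π.injective.eq_iff]
    simp only [Equiv.Perm.mul_apply, hd', hz', h3, h4, Prod.mk.injEq]
  have h1 : ∑ σ with Escapes d z σ, w σ = O.offDiag.card * q := by
    rw [← hq _ subset_rfl]
    refine Finset.sum_congr (Finset.filter_congr fun σ _ => ?_) fun _ _ => rfl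
    simp only [Escapes, Finset.mem_offDiag, hmemO, ne_eq, EmbeddingLike.apply_eq_iff_eq, hdz]
    tauto
  set R := (O ∩ C).offDiag ∪ (O \ C).offDiag with hRdef
  have h2 : ∑ σ with Escapes d z σ ∧ (σ d ∈ C ↔ σ z ∈ C), w σ = R.card * q := by
    rw [← hq R (Finset.union_subset (Finset.offDiag_mono Finset.inter_subset_left)
      (Finset.offDiag_mono Finset.sdiff_subset))]
    refine Finset.sum_congr (Finset.filter_congr fun σ _ => ?_) fun _ _ => rfl
    simp only [hRdef, Escapes, Finset.mem_union, Finset.mem_offDiag, Finset.mem_inter,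
      Finset.mem_sdiff, hmemO, ne_eq, EmbeddingLike.apply_eq_iff_eq, hdz]
    tauto
  have hR : (O.offDiag.card : ℝ) ≤ 4 * R.card := by
    have hdisj : Disjoint (O ∩ C).offDiag (O \ C).offDiag := by
      rw [Finset.disjoint_left]
      rintro ⟨x, y⟩ hx hy
      simp only [Finset.mem_offDiag, Finset.mem_inter, Finset.mem_sdiff] at hx hy
      exact hy.1.2 hx.1.2
    have hadd := Finset.card_inter_add_card_sdiff O C
    have hcast : ∀ s : Finset α, (s.offDiag.card : ℝ) = s.card * s.card - s.card := fun s => by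
      rw [Finset.offDiag_card, Nat.cast_sub (Nat.le_mul_self _)]
      push_cast; ring
    have h3 : (3 : ℝ) ≤ O.card := by exact_mod_cast (by omega : 3 ≤ O.card)
    have hadd' : ((O ∩ C).card : ℝ) + (O \ C).card = O.card := by exact_mod_cast hadd
    rw [hRdef, Finset.card_union_of_disjoint hdisj]
    push_cast
    rw [hcast, hcast, hcast]
    nlinarith [sq_nonneg (((O ∩ C).card : ℝ) - (O \ C).card)]
  rw [h1, h2]
  nlinarith

end ClassFunction

/-! ### Coalescence at a meeting -/

section Coalescence

variable {V : Type*} [DecidableEq V]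

theorem image_swap_of_iff {d z : V} {B : Finset V} (h : d ∈ B ↔ z ∈ B) :
    B.image (Equiv.swap d z) = B := by
  ext v
  have h1 : v ∈ B.image (Equiv.swap d z) ↔ Equiv.swap d z v ∈ B := by
    rw [Finset.mem_image]
    constructor
    · rintro ⟨u, hu, rfl⟩; simpa using hu
    · intro hv; exact ⟨_, hv, by simp⟩
  rw [h1, Equiv.swap_apply_def]
  split_ifs with h2 h3
  · rw [h2, h]
  · rw [h3, h]
  · rfl

theorem mem_image_perm (g : Equiv.Perm V) (A : Finset V) (v : V) :
    v ∈ A.image g ↔ g⁻¹ v ∈ A := by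
  rw [Finset.mem_image]
  constructor
  · rintro ⟨u, hu, rfl⟩; simpa using hu
  · intro hv; exact ⟨_, hv, by simp⟩

variable {e : Finset V} {w : Equiv.Perm {v // v ∈ e} → ℝ} {C : Finset V} {d z : V}

theorem extend_inv_apply (σ : Equiv.Perm {v // v ∈ e}) (v : {v // v ∈ e}) :
    (extend σ)⁻¹ v.1 = (σ⁻¹ v).1 := by
  rw [extend, ← map_inv, Equiv.Perm.ofSubtype_apply_coe]

/-- If the sites `d` and `z` are filled by `σ` from outside of `{d, z}`, both by particles of `C` or
both by none, then conjugating `σ` by the transposition of `d` and `z` makes the two configurations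
agree. -/
theorem sum_escapes_same_class_eq_zero (hc : ∀ σ τ, IsConj σ τ → w σ = w τ) (hd : d ∈ e)
    (hz : z ∈ e) (hdC : d ∉ C) (hzC : z ∉ C) (h : Finset V → ℝ) :
    ∑ σ with Escapes ⟨d, hd⟩ ⟨z, hz⟩ σ⁻¹ ∧ ((σ⁻¹ ⟨d, hd⟩).1 ∈ C ↔ (σ⁻¹ ⟨z, hz⟩).1 ∈ C),
      w σ * (h ((insert d C).image (extend σ)) - h ((insert z C).image (extend σ))) = 0 := by
  simp only [mul_sub, Finset.sum_sub_distrib]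
  rw [sub_eq_zero]
  set τ : Equiv.Perm {v // v ∈ e} := Equiv.swap ⟨d, hd⟩ ⟨z, hz⟩ with hτ
  have hττ : τ⁻¹ = τ := by rw [hτ, Equiv.swap_inv]
  have hτd : τ ⟨d, hd⟩ = ⟨z, hz⟩ := Equiv.swap_apply_left _ _
  have hτz : τ ⟨z, hz⟩ = ⟨d, hd⟩ := Equiv.swap_apply_right _ _
  have hconj : ∀ σ, (MulAut.conj τ) σ = τ * σ * τ := fun σ => by
    rw [MulAut.conj_apply, hττ]
  have hswap : extend τ = Equiv.swap d z := Equiv.Perm.ofSubtype_swap_eq _ _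
  have hτfix : ∀ v, v ≠ ⟨d, hd⟩ → v ≠ ⟨z, hz⟩ → τ v = v := fun v h1 h2 =>
    Equiv.swap_apply_of_ne_of_ne h1 h2
  refine Finset.sum_equiv (MulAut.conj τ).toEquiv (fun σ => ?_) fun σ hσ => ?_
  · simp only [Finset.mem_filter, Finset.mem_univ, true_and]
    change _ ↔ Escapes _ _ ((MulAut.conj τ) σ)⁻¹ ∧ ((((MulAut.conj τ) σ)⁻¹ _).1 ∈ C ↔
      (((MulAut.conj τ) σ)⁻¹ _).1 ∈ C)
    have h1 : ∀ v, τ v ≠ ⟨d, hd⟩ ∧ τ v ≠ ⟨z, hz⟩ → v ≠ ⟨d, hd⟩ ∧ v ≠ ⟨z, hz⟩ := fun v h =>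
      ⟨by rintro rfl; exact h.2 hτd, by rintro rfl; exact h.1 hτz⟩
    have h2 : ((MulAut.conj τ) σ)⁻¹ = τ * σ⁻¹ * τ := by
      rw [hconj]; simp [mul_assoc, hττ]
    rw [h2]
    simp only [Escapes, Equiv.Perm.mul_apply, hτd, hτz]
    constructor
    · rintro ⟨⟨a1, a2, a3, a4⟩, a5⟩
      rw [hτfix _ a1 a2, hτfix _ a3 a4]
      exact ⟨⟨a3, a4, a1, a2⟩, a5.symm⟩
    · rintro ⟨⟨a1, a2, a3, a4⟩, a5⟩
      obtain ⟨b1, b2⟩ := h1 _ ⟨a3, a4⟩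
      obtain ⟨b3, b4⟩ := h1 _ ⟨a1, a2⟩
      rw [hτfix _ b1 b2, hτfix _ b3 b4] at a5
      exact ⟨⟨b1, b2, b3, b4⟩, a5.symm⟩
  · simp only [Finset.mem_filter, Finset.mem_univ, true_and] at hσ
    obtain ⟨⟨a1, a2, a3, a4⟩, a5⟩ := hσ
    change w σ * _ = w ((MulAut.conj τ) σ) * h ((insert z C).image (extend ((MulAut.conj τ) σ)))
    rw [← hc σ ((MulAut.conj τ) σ) (isConj_iff.2 ⟨τ, rfl⟩), hconj]
    congr 2
    have h1 : (extend (τ * σ * τ) : V → V) = (Equiv.swap d z) ∘ (extend σ) ∘ (Equiv.swap d z) := by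
      rw [extend, map_mul, map_mul, ← extend, ← extend, hswap]
      rfl
    rw [h1, ← Finset.image_image, ← Finset.image_image, Finset.image_insert (Equiv.swap d z),
      Equiv.swap_apply_right, image_swap_of_iff (B := C) (by simp [hdC, hzC]), image_swap_of_iff]
    rw [mem_image_perm, mem_image_perm, extend_inv_apply σ ⟨d, hd⟩, extend_inv_apply σ ⟨z, hz⟩]
    have hne : (σ⁻¹ ⟨d, hd⟩).1 ≠ d := fun h => a1 (Subtype.ext h)
    have hne' : (σ⁻¹ ⟨z, hz⟩).1 ≠ d := fun h => a3 (Subtype.ext h)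
    rw [Finset.mem_insert, Finset.mem_insert, or_iff_right hne, or_iff_right hne']
    exact a5

theorem sum_filter_inv (hc : ∀ σ τ, IsConj σ τ → w σ = w τ)
    (p : Equiv.Perm {v // v ∈ e} → Prop) [DecidablePred p] :
    ∑ σ with p σ⁻¹, w σ = ∑ σ with p σ, w σ := by
  refine Finset.sum_equiv (Equiv.inv _) (fun σ => by simp) fun σ _ => hc _ _ ?_
  rw [Equiv.Perm.isConj_iff_cycleType_eq]
  simp

theorem exists_coalescing_of_four_le (hw0 : ∀ σ, 0 ≤ w σ) (hw1 : ∑ σ, w σ = 1)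
    (hc : ∀ σ τ, IsConj σ τ → w σ = w τ) (hfix : ∀ v, ∑ σ with σ v = v, w σ ≤ 1 / 5)
    (hcard : 4 ≤ e.card) (hd : d ∈ e) (hz : z ∈ e) (hdz : d ≠ z) (hdC : d ∉ C) (hzC : z ∉ C)
    (hclean : ¬ (e.card = 4 ∧ (e ∩ C).card = 1)) :
    ∃ S : Finset (Equiv.Perm {v // v ∈ e}), 1 / 60 ≤ ∑ σ ∈ S, w σ ∧ ∀ h : Finset V → ℝ,
      ∑ σ ∈ S, w σ * (h ((insert d C).image (extend σ)) - h ((insert z C).image (extend σ)))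
        = 0 := by
  refine ⟨_, ?_, sum_escapes_same_class_eq_zero hc hd hz hdC hzC⟩
  have hdz' : (⟨d, hd⟩ : {v // v ∈ e}) ≠ ⟨z, hz⟩ := fun h => hdz (congrArg Subtype.val h)
  rw [sum_filter_inv hc (fun σ => Escapes ⟨d, hd⟩ ⟨z, hz⟩ σ ∧
    ((σ ⟨d, hd⟩).1 ∈ C ↔ (σ ⟨z, hz⟩).1 ∈ C))]
  have hα : Fintype.card {v // v ∈ e} = e.card := Fintype.card_coe e
  rcases hcard.eq_or_lt with h4 | h5
  · have h1 := sum_escapes_of_card_eq_four hw0 hw1 hc hfix (hα.trans h4.symm) hdz'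
    refine h1.trans (le_of_eq (Finset.sum_congr (Finset.filter_congr fun σ _ => ?_) fun _ _ => rfl))
    refine ⟨fun hE => ⟨hE, ?_⟩, fun hE => hE.1⟩
    -- the two images exhaust `e \ {d, z}`, which holds all or none of the two elements of `C`
    by_contra hne
    refine hclean ⟨h4.symm, ?_⟩
    have hsub : ({d, z, (σ ⟨d, hd⟩).1, (σ ⟨z, hz⟩).1} : Finset V) ⊆ e := by
      simp [Finset.insert_subset_iff, hd, hz]
    obtain ⟨a1, a2, a3, a4⟩ := hE
    have hne' : (σ ⟨d, hd⟩).1 ≠ (σ ⟨z, hz⟩).1 := fun h => hdz' (σ.injective (Subtype.ext h))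
    have hc4 : ({d, z, (σ ⟨d, hd⟩).1, (σ ⟨z, hz⟩).1} : Finset V).card = 4 := by
      rw [Finset.card_insert_of_notMem, Finset.card_insert_of_notMem, Finset.card_pair hne']
      · simp only [Finset.mem_insert, Finset.mem_singleton, not_or]
        exact ⟨fun h => a2 (Subtype.ext h.symm), fun h => a4 (Subtype.ext h.symm)⟩
      · simp only [Finset.mem_insert, Finset.mem_singleton, not_or]
        exact ⟨hdz, fun h => a1 (Subtype.ext h.symm), fun h => a3 (Subtype.ext h.symm)⟩
    have he := Finset.eq_of_subset_of_card_le hsub (by rw [hc4, ← h4])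
    rw [← he, Finset.insert_inter_of_notMem hdC, Finset.insert_inter_of_notMem hzC]
    by_cases hC : (σ ⟨d, hd⟩).1 ∈ C
    · rw [Finset.insert_inter_of_mem hC, Finset.singleton_inter_of_notMem (by tauto)]
      simp
    · rw [Finset.insert_inter_of_notMem hC, Finset.singleton_inter_of_mem (by tauto)]
      simp
  · have h1 := sum_escapes_of_five_le hw0 hw1 hc hfix (by omega) hdz'
    have h2 := sum_escapes_le_same_class hw0 hc (by omega) hdz' (C.subtype (· ∈ e))
    simp only [Finset.mem_subtype] at h2
    linarith

theorem exists_coalescing_of_card_eq_two (hw0 : ∀ σ, 0 ≤ w σ) (hw1 : ∑ σ, w σ = 1)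
    (hfix : ∀ v, ∑ σ with σ v = v, w σ ≤ 1 / 5)
    (hcard : e.card = 2) (hd : d ∈ e) (hz : z ∈ e) (hdz : d ≠ z) (hdC : d ∉ C) (hzC : z ∉ C) :
    ∃ S : Finset (Equiv.Perm {v // v ∈ e}), ∃ θ : ℝ, 0 ≤ θ ∧ 1 / 60 ≤ ∑ σ ∈ S, w σ ∧
      ∀ h : Finset V → ℝ,
      ∑ σ ∈ S, w σ * (h ((insert d C).image (extend σ)) - h ((insert z C).image (extend σ)))
        = - θ * (h (insert d C) - h (insert z C)) := by
  have hdz' : (⟨d, hd⟩ : {v // v ∈ e}) ≠ ⟨z, hz⟩ := fun h => hdz (congrArg Subtype.val h)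
  have he : e = {d, z} := (Finset.eq_of_subset_of_card_le
    (by simp [Finset.insert_subset_iff, hd, hz]) (by rw [hcard, Finset.card_pair hdz])).symm
  have hv : ∀ v : {v // v ∈ e}, v = ⟨d, hd⟩ ∨ v = ⟨z, hz⟩ := fun v => by
    have : v.1 ∈ ({d, z} : Finset V) := he ▸ v.2
    simpa [Subtype.ext_iff] using this
  refine ⟨Finset.univ.filter fun σ => σ ⟨d, hd⟩ ≠ ⟨d, hd⟩,
    ∑ σ with σ ⟨d, hd⟩ ≠ ⟨d, hd⟩, w σ, Finset.sum_nonneg fun σ _ => hw0 σ, ?_, fun h => ?_⟩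
  · have h1 := Finset.sum_filter_add_sum_filter_not Finset.univ
      (fun σ : Equiv.Perm {v // v ∈ e} => σ ⟨d, hd⟩ = ⟨d, hd⟩) w
    have h2 := hfix ⟨d, hd⟩
    rw [hw1] at h1
    simp only [ne_eq]
    linarith
  · rw [← Finset.sum_neg_distrib, Finset.sum_mul]
    refine Finset.sum_congr rfl fun σ hσ => ?_
    have hσd : σ ⟨d, hd⟩ = ⟨z, hz⟩ := (hv _).resolve_left (Finset.mem_filter.1 hσ).2
    have hσz : σ ⟨z, hz⟩ = ⟨d, hd⟩ := (hv _).resolve_right fun h =>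
      hdz' (σ.injective (hσd.trans h.symm))
    have hσ : σ = Equiv.swap ⟨d, hd⟩ ⟨z, hz⟩ := Equiv.ext fun v => by
      rcases hv v with rfl | rfl
      · rw [hσd, Equiv.swap_apply_left]
      · rw [hσz, Equiv.swap_apply_right]
    have hg : extend σ = Equiv.swap d z := by rw [hσ]; exact Equiv.Perm.ofSubtype_swap_eq _ _
    rw [hg, Finset.image_insert, Finset.image_insert, Equiv.swap_apply_left,
      Equiv.swap_apply_right, image_swap_of_iff (by simp [hdC, hzC])]
    ring

/-- For an edge of three vertices the two cyclic permutations are used: their contributions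
telescope. -/
theorem exists_coalescing_of_card_eq_three (hw0 : ∀ σ, 0 ≤ w σ) (hw1 : ∑ σ, w σ = 1)
    (hc : ∀ σ τ, IsConj σ τ → w σ = w τ) (hfix : ∀ v, ∑ σ with σ v = v, w σ ≤ 1 / 5)
    (hcard : e.card = 3) (hd : d ∈ e) (hz : z ∈ e) (hdz : d ≠ z) (hdC : d ∉ C) (hzC : z ∉ C) :
    ∃ S : Finset (Equiv.Perm {v // v ∈ e}), ∃ θ : ℝ, 0 ≤ θ ∧ 1 / 60 ≤ ∑ σ ∈ S, w σ ∧
      ∀ h : Finset V → ℝ,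
      ∑ σ ∈ S, w σ * (h ((insert d C).image (extend σ)) - h ((insert z C).image (extend σ)))
        = - θ * (h (insert d C) - h (insert z C)) := by
  obtain ⟨y, hye, hyd⟩ : ∃ y ∈ e, y ∉ ({d, z} : Finset V) := by
    by_contra! h
    have h1 := Finset.card_le_card (show e ⊆ {d, z} from h)
    rw [hcard, Finset.card_pair hdz] at h1
    omega
  simp only [Finset.mem_insert, Finset.mem_singleton, not_or] at hyd
  obtain ⟨hyd, hyz⟩ := hyd
  have he : e = {d, z, y} := (Finset.eq_of_subset_of_card_le
    (by simp [Finset.insert_subset_iff, hd, hz, hye])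
    (by rw [hcard, Finset.card_eq_three.2 ⟨d, z, y, hdz, Ne.symm hyd, Ne.symm hyz, rfl⟩])).symm
  have hv : ∀ v : {v // v ∈ e}, v = ⟨d, hd⟩ ∨ v = ⟨z, hz⟩ ∨ v = ⟨y, hye⟩ := fun v => by
    have : v.1 ∈ ({d, z, y} : Finset V) := he ▸ v.2
    simpa [Subtype.ext_iff] using this
  set D : {v // v ∈ e} := ⟨d, hd⟩
  set Z : {v // v ∈ e} := ⟨z, hz⟩
  set Y : {v // v ∈ e} := ⟨y, hye⟩
  have hDZ : D ≠ Z := fun h => hdz (congrArg Subtype.val h)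
  have hYD : Y ≠ D := fun h => hyd (congrArg Subtype.val h)
  have hYZ : Y ≠ Z := fun h => hyz (congrArg Subtype.val h)
  set γ : Equiv.Perm {v // v ∈ e} := Equiv.swap D Z * Equiv.swap Z Y with hγ
  have hγD : γ D = Z := by
    rw [hγ, Equiv.Perm.mul_apply, Equiv.swap_apply_of_ne_of_ne hDZ hYD.symm,
      Equiv.swap_apply_left]
  have hγZ : γ Z = Y := by
    rw [hγ, Equiv.Perm.mul_apply, Equiv.swap_apply_left,
      Equiv.swap_apply_of_ne_of_ne hYD hYZ]
  have hγY : γ Y = D := by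
    rw [hγ, Equiv.Perm.mul_apply, Equiv.swap_apply_right, Equiv.swap_apply_right]
  have hγ'Z : γ⁻¹ Z = D := by rw [Equiv.Perm.inv_eq_iff_eq, hγD]
  have hγ'Y : γ⁻¹ Y = Z := by rw [Equiv.Perm.inv_eq_iff_eq, hγZ]
  have hγ'D : γ⁻¹ D = Y := by rw [Equiv.Perm.inv_eq_iff_eq, hγY]
  have hne : γ ≠ γ⁻¹ := fun h => by
    have := congrArg (fun g => g D) h
    simp only [hγD, hγ'D] at this
    exact hYZ this.symm
  have hwγ : w γ⁻¹ = w γ := hc _ _ (by rw [Equiv.Perm.isConj_iff_cycleType_eq]; simp)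
  have hder : (Finset.univ.filter fun σ : Equiv.Perm {v // v ∈ e} => ∀ i, σ i ≠ i)
      ⊆ {γ, γ⁻¹} := by
    intro σ hσ
    have hσ := (Finset.mem_filter.1 hσ).2
    rw [Finset.mem_insert, Finset.mem_singleton]
    have hinj := fun {a b c} (h1 : σ a = c) (h2 : σ b = c) => σ.injective (h1.trans h2.symm)
    rcases hv (σ D) with h | h | h
    · exact absurd h (hσ D)
    · left
      have h2 : σ Z = Y := by
        rcases hv (σ Z) with h2 | h2 | h2
        · rcases hv (σ Y) with h3 | h3 | h3
          · exact absurd (hinj h2 h3) hYZ.symm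
          · exact absurd (hinj h h3) hYD.symm
          · exact absurd h3 (hσ Y)
        · exact absurd h2 (hσ Z)
        · exact h2
      have h3 : σ Y = D := by
        rcases hv (σ Y) with h3 | h3 | h3
        · exact h3
        · exact absurd (hinj h h3) hYD.symm
        · exact absurd h3 (hσ Y)
      refine Equiv.ext fun v => ?_
      rcases hv v with rfl | rfl | rfl
      · rw [h, hγD]
      · rw [h2, hγZ]
      · rw [h3, hγY]
    · right
      have h2 : σ Y = Z := by
        rcases hv (σ Y) with h2 | h2 | h2
        · rcases hv (σ Z) with h3 | h3 | h3
          · exact absurd (hinj h2 h3) hYZ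
          · exact absurd h3 (hσ Z)
          · exact absurd (hinj h h3) hDZ
        · exact h2
        · exact absurd h2 (hσ Y)
      have h3 : σ Z = D := by
        rcases hv (σ Z) with h3 | h3 | h3
        · exact h3
        · exact absurd h3 (hσ Z)
        · exact absurd (hinj h h3) hDZ
      refine Equiv.ext fun v => ?_
      rcases hv v with rfl | rfl | rfl
      · rw [h, hγ'D]
      · rw [h3, hγ'Z]
      · rw [h2, hγ'Y]
  refine ⟨{γ, γ⁻¹}, w γ, hw0 γ, ?_, fun h => ?_⟩
  · have h1 := one_sub_le_sum_derangement hw0 hw1 hfix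
    have h2 := Finset.sum_le_sum_of_subset_of_nonneg hder fun σ _ _ => hw0 σ
    rw [Fintype.card_coe, hcard] at h1
    simp only [Nat.cast_ofNat] at h1
    linarith
  · rw [Finset.sum_pair hne, hwγ]
    have hg : ∀ σ : Equiv.Perm {v // v ∈ e}, ∀ v : {v // v ∈ e}, extend σ v.1 = (σ v).1 :=
      fun σ v => Equiv.Perm.ofSubtype_apply_coe σ v
    have hgd : extend γ d = z := by rw [hg γ D, hγD]
    have hgz : extend γ z = y := by rw [hg γ Z, hγZ]
    have hgy : extend γ y = d := by rw [hg γ Y, hγY]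
    have hg'd : extend γ⁻¹ d = y := by rw [hg γ⁻¹ D, hγ'D]
    have hg'z : extend γ⁻¹ z = d := by rw [hg γ⁻¹ Z, hγ'Z]
    have hg'y : extend γ⁻¹ y = z := by rw [hg γ⁻¹ Y, hγ'Y]
    have himage : ∀ σ : Equiv.Perm {v // v ∈ e}, ∀ B : Finset V, d ∉ B → z ∉ B → y ∉ B →
        B.image (extend σ) = B := fun σ B h1 h2 h3 => by
      rw [Finset.image_congr (g := id), Finset.image_id]
      intro v hv
      refine Equiv.Perm.ofSubtype_apply_of_not_mem σ ?_
      rw [he]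
      simp only [Finset.mem_insert, Finset.mem_singleton, not_or]
      exact ⟨fun h => h1 (h ▸ hv), fun h => h2 (h ▸ hv), fun h => h3 (h ▸ hv)⟩
    by_cases hyC : y ∈ C
    · obtain ⟨B, hyB, rfl⟩ : ∃ B, y ∉ B ∧ insert y B = C :=
        ⟨C.erase y, Finset.notMem_erase _ _, Finset.insert_erase hyC⟩
      simp only [Finset.mem_insert, not_or] at hdC hzC
      simp only [Finset.image_insert, himage _ B hdC.2 hzC.2 hyB, hgd, hgz, hgy, hg'd, hg'z, hg'y]
      rw [Finset.insert_comm z d, Finset.insert_comm y z B, Finset.insert_comm y d B]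
      ring
    · simp only [Finset.image_insert, himage _ C hdC hzC hyC, hgd, hgz, hg'd, hg'z]
      ring

/-- At a ring of an edge `e` containing `d` and `z`, unless `e` has four vertices of which exactly
one is in `C`, a set `S` of permutations of mass bounded below either identifies the images of the
configurations `insert d C` and `insert z C`, in law, or lowers their difference. -/
theorem exists_coalescing (hw0 : ∀ σ, 0 ≤ w σ) (hw1 : ∑ σ, w σ = 1)
    (hc : ∀ σ τ, IsConj σ τ → w σ = w τ) (hfix : ∀ v, ∑ σ with σ v = v, w σ ≤ 1 / 5)
    (hd : d ∈ e) (hz : z ∈ e) (hdz : d ≠ z) (hdC : d ∉ C) (hzC : z ∉ C)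
    (hclean : ¬ (e.card = 4 ∧ (e ∩ C).card = 1)) :
    ∃ S : Finset (Equiv.Perm {v // v ∈ e}), ∃ θ : ℝ, 0 ≤ θ ∧ 1 / 60 ≤ ∑ σ ∈ S, w σ ∧
      ∀ h : Finset V → ℝ,
      ∑ σ ∈ S, w σ * (h ((insert d C).image (extend σ)) - h ((insert z C).image (extend σ)))
        = - θ * (h (insert d C) - h (insert z C)) := by
  have h2 : 2 ≤ e.card := by
    rw [← Finset.card_pair hdz]
    exact Finset.card_le_card (by simp [Finset.insert_subset_iff, hd, hz])
  rcases h2.eq_or_lt with h2 | h3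
  · exact exists_coalescing_of_card_eq_two hw0 hw1 hfix h2.symm hd hz hdz hdC hzC
  rcases (show 3 ≤ e.card from h3).eq_or_lt with h3 | h4
  · exact exists_coalescing_of_card_eq_three hw0 hw1 hc hfix h3.symm hd hz hdz hdC hzC
  · obtain ⟨S, h1, h2⟩ := exists_coalescing_of_four_le hw0 hw1 hc hfix h4 hd hz hdz hdC hzC hclean
    exact ⟨S, 0, le_rfl, h1, fun h => by rw [h2 h]; ring⟩

end Coalescence

/-! ### Adjacent configurations and their coupling -/

section Adjacent

variable {V : Type*} [DecidableEq V] [Fintype V] {E : Finset (Finset V)} {f : EdgeWeights E}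

/-- A pair of adjacent configurations `insert d C` and `insert z C` of `m + 1` particles, encoded by
the triple `(C, d, z)`: the common particles `C`, and the two discrepancies `d ≠ z`. -/
abbrev Adjacent (V : Type*) (m : ℕ) : Type _ :=
  {x : Finset V × V × V // x.1.card = m ∧ x.2.1 ∉ x.1 ∧ x.2.2 ∉ x.1 ∧ x.2.1 ≠ x.2.2}

variable {m : ℕ}

/-- The action of permutations on pairs of adjacent configurations. -/
def adjAct (g : Equiv.Perm V) (x : Adjacent V m) : Adjacent V m :=
  ⟨(x.1.1.image g, pairAct g x.1.2), by
    rw [Finset.card_image_of_injective _ g.injective]; exact x.2.1,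
    fun h => x.2.2.1 (by simpa [pairAct] using h), fun h => x.2.2.2.1 (by simpa [pairAct] using h),
    fun h => x.2.2.2.2 (g.injective h)⟩

/-- The configuration `insert d C`. -/
def Adjacent.left (x : Adjacent V m) : {A : Finset V // A.card = m + 1} :=
  ⟨insert x.1.2.1 x.1.1, by rw [Finset.card_insert_of_notMem x.2.2.1, x.2.1]⟩

/-- The configuration `insert z C`. -/
def Adjacent.right (x : Adjacent V m) : {A : Finset V // A.card = m + 1} :=
  ⟨insert x.1.2.2 x.1.1, by rw [Finset.card_insert_of_notMem x.2.2.2.1, x.2.1]⟩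

theorem left_adjAct (g : Equiv.Perm V) (x : Adjacent V m) :
    (adjAct g x).left = setAct (m + 1) g x.left :=
  Subtype.ext (Finset.image_insert g _ _).symm

theorem right_adjAct (g : Equiv.Perm V) (x : Adjacent V m) :
    (adjAct g x).right = setAct (m + 1) g x.right :=
  Subtype.ext (Finset.image_insert g _ _).symm

/-- The difference of a function between adjacent configurations. -/
def adjDiff : ({A : Finset V // A.card = m + 1} → ℝ) →ₗ[ℝ] (Adjacent V m → ℝ) :=
  LinearMap.funLeft ℝ ℝ Adjacent.left - LinearMap.funLeft ℝ ℝ Adjacent.right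

theorem adjDiff_apply (h : {A : Finset V // A.card = m + 1} → ℝ) (x : Adjacent V m) :
    adjDiff h x = h x.left - h x.right := rfl

/-- The two discrepancies are in the edge `e`. -/
def AdjMeets (e : {e // e ∈ E}) (x : Adjacent V m) : Prop := Meets e x.1.2

instance (e : {e // e ∈ E}) (x : Adjacent V m) : Decidable (AdjMeets e x) := by
  unfold AdjMeets; infer_instance

/-- The edge `e` has four vertices, exactly one of which carries a common particle. A ring of such
an edge need not bring the two configurations together: if only double transpositions have
positive weight, then both configurations keep splitting the edge into two pairs. -/
def Obstructs (e : {e // e ∈ E}) (x : Adjacent V m) : Prop :=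
  e.1.card = 4 ∧ (e.1 ∩ x.1.1).card = 1

instance (e : {e // e ∈ E}) (x : Adjacent V m) : Decidable (Obstructs e x) := by
  unfold Obstructs; infer_instance

/-- The data of a coupling of adjacent configurations: for each edge `e`, the set `S e x` of
permutations used to bring the configurations together, and an additional rate `θ e x` of
coalescence coming from moving only one of the two configurations. -/
structure CoalescingData (f : EdgeWeights E) (m : ℕ) where
  S : ∀ e : {e // e ∈ E}, Adjacent V m → Finset (Equiv.Perm {v // v ∈ e.1})
  θ : {e // e ∈ E} → Adjacent V m → ℝ
  nonneg : ∀ e x, 0 ≤ θ e x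
  empty : ∀ e x, ¬ AdjMeets e x → S e x = ∅
  mass : ∀ e x, AdjMeets e x → ¬ Obstructs e x → 1 / 60 ≤ ∑ σ ∈ S e x, f e σ
  cancel : ∀ e x (h : {A : Finset V // A.card = m + 1} → ℝ),
    ∑ σ ∈ S e x, f e σ * adjDiff h (adjAct (extend σ) x) = - θ e x * adjDiff h x

theorem nonempty_coalescingData (hf : IsProbability f) (hadm : Admissible f) (m : ℕ) :
    Nonempty (CoalescingData f m) := by
  classical
  have key : ∀ e (x : Adjacent V m), ∃ S : Finset (Equiv.Perm {v // v ∈ e.1}), ∃ θ : ℝ, 0 ≤ θ ∧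
      (¬ AdjMeets e x → S = ∅) ∧ (AdjMeets e x → ¬ Obstructs e x → 1 / 60 ≤ ∑ σ ∈ S, f e σ) ∧
      ∀ h : {A : Finset V // A.card = m + 1} → ℝ,
        ∑ σ ∈ S, f e σ * adjDiff h (adjAct (extend σ) x) = - θ * adjDiff h x := by
    intro e x
    by_cases hx : AdjMeets e x ∧ ¬ Obstructs e x
    · obtain ⟨S, θ, h1, h2, h3⟩ := exists_coalescing (C := x.1.1) (d := x.1.2.1) (z := x.1.2.2)
        (hf e).1 (hf e).2 (hadm.classFunction e)
        (fun v => by rw [Finset.sum_filter]; exact hadm.fixedPoint e v) hx.1.1 hx.1.2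
        x.2.2.2.2 x.2.2.1 x.2.2.2.1 hx.2
      refine ⟨S, θ, h1, fun h => absurd hx.1 h, fun _ _ => h2, fun h => ?_⟩
      have h4 := h3 fun A => if hA : A.card = m + 1 then h ⟨A, hA⟩ else 0
      have hl := x.left.2
      have hr := x.right.2
      simp only [Adjacent.left, Adjacent.right] at hl hr
      have hl' : ∀ g : Equiv.Perm V, ((insert x.1.2.1 x.1.1).image g).card = m + 1 := fun g => by
        rw [Finset.card_image_of_injective _ g.injective, hl]
      have hr' : ∀ g : Equiv.Perm V, ((insert x.1.2.2 x.1.1).image g).card = m + 1 := fun g => by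
        rw [Finset.card_image_of_injective _ g.injective, hr]
      simp only [hl, hr, hl', hr', dif_pos] at h4
      simp only [adjDiff_apply, left_adjAct, right_adjAct]
      exact h4
    · exact ⟨∅, 0, le_rfl, fun _ => rfl, fun h1 h2 => absurd ⟨h1, h2⟩ hx, fun h => by simp⟩
  choose S θ h1 h2 h3 h4 using key
  exact ⟨⟨S, θ, h1, h2, h3, h4⟩⟩

variable (D : CoalescingData f m)

/-- The operator satisfied by the differences of a solution between adjacent configurations. -/
def coalGenExact : (Adjacent V m → ℝ) →ₗ[ℝ] (Adjacent V m → ℝ) :=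
  jumpOp f adjAct (fun e σ x => if σ ∈ D.S e x then 0 else 1) (fun e x => 1 + D.θ e x)

/-- The pair of adjacent configurations, killed when a permutation in `S` is used. -/
def coalGen : (Adjacent V m → ℝ) →ₗ[ℝ] (Adjacent V m → ℝ) :=
  jumpOp f adjAct (fun e σ x => if σ ∈ D.S e x then 0 else 1) (fun _ _ => 1)

theorem quasiPositive_coalGen (hf : IsProbability f) : QuasiPositive (coalGen D) :=
  quasiPositive_jumpOp hf fun e σ x => by split_ifs <;> norm_num

theorem quasiPositive_coalGenExact (hf : IsProbability f) : QuasiPositive (coalGenExact D) :=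
  quasiPositive_jumpOp hf fun e σ x => by split_ifs <;> norm_num

theorem adjDiff_ringGen (h : {A : Finset V // A.card = m + 1} → ℝ) :
    adjDiff (ringGen f (setAct (m + 1)) h) = coalGenExact D (adjDiff h) := by
  ext x
  rw [adjDiff_apply, coalGenExact]
  simp only [jumpOp_apply, one_mul]
  rw [← Finset.sum_sub_distrib]
  refine Finset.sum_congr rfl fun e _ => ?_
  have h1 : ∑ σ, f e σ * ((if σ ∈ D.S e x then 0 else 1) * adjDiff h (adjAct (extend σ) x))
      = ∑ σ, f e σ * adjDiff h (adjAct (extend σ) x) + D.θ e x * adjDiff h x := by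
    have h2 : ∀ σ : Equiv.Perm {v // v ∈ e.1},
        f e σ * ((if σ ∈ D.S e x then 0 else 1) * adjDiff h (adjAct (extend σ) x))
        = f e σ * adjDiff h (adjAct (extend σ) x)
          - if σ ∈ D.S e x then f e σ * adjDiff h (adjAct (extend σ) x) else 0 := fun σ => by
      split_ifs <;> ring
    have h3 := D.cancel e x h
    rw [Finset.sum_congr rfl fun σ _ => h2 σ, Finset.sum_sub_distrib, Finset.sum_ite_mem,
      Finset.univ_inter, h3]
    ring
  rw [h1]
  simp only [adjDiff_apply, left_adjAct, right_adjAct, mul_sub, Finset.sum_sub_distrib]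
  ring

/-- The difference of a solution between adjacent configurations is controlled by the probability
that the coupling has not yet brought them together. -/
theorem abs_adjDiff_heat_le (hf : IsProbability f) {t ℓ : ℝ} (ht : 0 ≤ t)
    {h : {A : Finset V // A.card = m + 1} → ℝ} (hh : ∀ x : Adjacent V m, |adjDiff h x| ≤ ℓ)
    (x : Adjacent V m) :
    |adjDiff (heat (ringGen f (setAct (m + 1))) t h) x| ≤ ℓ * heat (coalGen D) t 1 x := by
  rw [map_heat _ adjDiff (adjDiff_ringGen D)]
  refine (abs_heat_le (quasiPositive_coalGenExact D hf) ht (v := fun x => |adjDiff h x|)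
    (fun _ => le_rfl) x).trans ?_
  refine (heat_le_heat (quasiPositive_coalGenExact D hf) (quasiPositive_coalGen D hf)
    (fun u hu y => ?_) ht (fun y => abs_nonneg _) x).trans ?_
  · rw [coalGen, coalGenExact, jumpOp_apply, jumpOp_apply]
    refine Finset.sum_le_sum fun e _ => sub_le_sub_left (mul_le_mul_of_nonneg_right ?_ (hu y)) _
    linarith [D.nonneg e y]
  · refine (heat_mono (quasiPositive_coalGen D hf) ht (v := ℓ • 1)
      (fun y => by simpa using hh y) x).trans ?_
    rw [heat_smul_fun]
    rfl

theorem coalGen_le_ringGen (hf : IsProbability f) {u : Adjacent V m → ℝ} (hu : 0 ≤ u) :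
    coalGen D u ≤ ringGen f adjAct u := by
  intro x
  rw [coalGen, jumpOp_apply, jumpOp_apply]
  refine Finset.sum_le_sum fun e _ => sub_le_sub_right (Finset.sum_le_sum fun σ _ => ?_) _
  refine mul_le_mul_of_nonneg_left (mul_le_mul_of_nonneg_right ?_ (hu _)) ((hf e).1 σ)
  split_ifs <;> norm_num

/-- The pair of adjacent configurations, killed when the discrepancies meet. -/
abbrev adjKilledGen (f : EdgeWeights E) (m : ℕ) : (Adjacent V m → ℝ) →ₗ[ℝ] (Adjacent V m → ℝ) :=
  killedGen f adjAct AdjMeets 1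

theorem adjKilledGen_le_coalGen (hf : IsProbability f) {u : Adjacent V m → ℝ} (hu : 0 ≤ u) :
    adjKilledGen f m u ≤ coalGen D u := by
  intro x
  rw [coalGen, jumpOp_apply, jumpOp_apply]
  refine Finset.sum_le_sum fun e _ => ?_
  simp only [ite_self]
  refine sub_le_sub_right (Finset.sum_le_sum fun σ _ => ?_) _
  refine mul_le_mul_of_nonneg_left (mul_le_mul_of_nonneg_right ?_ (hu _)) ((hf e).1 σ)
  by_cases hm : AdjMeets e x
  · rw [if_pos hm]
    split_ifs <;> norm_num
  · rw [if_neg hm, D.empty e x hm]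
    simp

/-- The number of edges at whose ring the coupling may bring the configurations together. -/
def cleanRate (E : Finset (Finset V)) (x : Adjacent V m) : ℝ :=
  ∑ e : {e // e ∈ E}, if AdjMeets e x ∧ ¬ Obstructs e x then 1 else 0

/-- The number of edges containing the discrepancies at whose ring nothing is gained. -/
def obstructedRate (E : Finset (Finset V)) (x : Adjacent V m) : ℝ :=
  ∑ e : {e // e ∈ E}, if AdjMeets e x ∧ Obstructs e x then 1 else 0

theorem adjKilledGen_one (hf : IsProbability f) :
    adjKilledGen f m 1 = -(cleanRate E + obstructedRate E) := by
  ext x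
  rw [killedGen_one hf, Pi.neg_apply, Pi.add_apply, cleanRate, obstructedRate,
    ← Finset.sum_add_distrib, ← Finset.sum_neg_distrib]
  refine Finset.sum_congr rfl fun e _ => ?_
  by_cases h1 : AdjMeets e x <;> by_cases h2 : Obstructs e x <;> simp [h1, h2]

theorem coalGen_one_le (hf : IsProbability f) :
    coalGen D 1 ≤ -((1 / 60 : ℝ) • (cleanRate E : Adjacent V m → ℝ)) := by
  intro x
  rw [coalGen, jumpOp_apply]
  simp only [Pi.neg_apply, Pi.smul_apply, cleanRate, smul_eq_mul, Finset.mul_sum]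
  rw [← Finset.sum_neg_distrib]
  refine Finset.sum_le_sum fun e _ => ?_
  have h1 : ∑ σ, f e σ * ((if σ ∈ D.S e x then 0 else 1) * (1 : Adjacent V m → ℝ)
      (adjAct (extend σ) x)) = 1 - ∑ σ ∈ D.S e x, f e σ := by
    have h2 : ∀ σ, f e σ * ((if σ ∈ D.S e x then 0 else 1) * (1 : Adjacent V m → ℝ)
        (adjAct (extend σ) x)) = f e σ - if σ ∈ D.S e x then f e σ else 0 := fun σ => by
      split_ifs <;> simp
    rw [Finset.sum_congr rfl fun σ _ => h2 σ, Finset.sum_sub_distrib, (hf e).2,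
      Finset.sum_ite_mem, Finset.univ_inter]
  rw [h1]
  simp only [Pi.one_apply]
  split_ifs with h
  · linarith [D.mass e x h.1 h.2]
  · linarith [Finset.sum_nonneg fun σ (_ : σ ∈ D.S e x) => (hf e).1 σ]

/-- The probability that the discrepancies have not met before time `t`, or that their first meeting
was at an edge where nothing is gained. -/
def failure (f : EdgeWeights E) (m : ℕ) (t : ℝ) : Adjacent V m → ℝ :=
  heat (adjKilledGen f m) t 1 + accum (adjKilledGen f m) t (obstructedRate E)

theorem failure_add_accum (hf : IsProbability f) (t : ℝ) :
    failure f m t + accum (adjKilledGen f m) t (cleanRate E) = 1 := by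
  have h := accum_generator (adjKilledGen f m) t 1
  rw [adjKilledGen_one hf, accum_neg_fun, accum_add_fun] at h
  ext x
  have hx := congrFun h x
  simp only [failure, Pi.neg_apply, Pi.add_apply, Pi.sub_apply] at hx ⊢
  linarith

theorem failure_nonneg (hf : IsProbability f) {t : ℝ} (ht : 0 ≤ t) : 0 ≤ failure f m t :=
  add_nonneg (heat_nonneg (quasiPositive_killedGen hf _ 1) ht fun _ => zero_le_one)
    (accum_nonneg (quasiPositive_killedGen hf _ 1) ht fun x =>
      Finset.sum_nonneg fun e _ => by split_ifs <;> norm_num)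

/-- Unless the time window is a failure, the coupling succeeds with probability `1 / 60`. -/
theorem heat_coalGen_one_le (hf : IsProbability f) {t : ℝ} (ht : 0 ≤ t) :
    heat (coalGen D) t 1 ≤ 1 - (1 / 60 : ℝ) • (1 - failure f m t) := by
  have hg : 1 - failure f m t = accum (adjKilledGen f m) t (cleanRate E) := by
    rw [← failure_add_accum hf t]; abel
  rw [hg]
  have h := nonneg_of_supersolution (quasiPositive_coalGen D hf)
    (y := fun s => 1 - (1 / 60 : ℝ) • accum (adjKilledGen f m) s (cleanRate E)
      - heat (coalGen D) s 1)
    (y' := fun s => 0 - (1 / 60 : ℝ) • heat (adjKilledGen f m) s (cleanRate E)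
      - coalGen D (heat (coalGen D) s 1))
    (fun s => (((hasDerivAt_const s (1 : Adjacent V m → ℝ)).sub
      ((hasDerivAt_accum _ s _).const_smul (1 / 60 : ℝ))).sub (hasDerivAt_heat _ s 1)))
    (fun s hs => ?_) (by simp) ht
  · exact sub_nonneg.1 h
  · have h1 := generator_accum (adjKilledGen f m) s (cleanRate E)
    have hacc : 0 ≤ accum (adjKilledGen f m) s (cleanRate E) :=
      accum_nonneg (quasiPositive_killedGen hf AdjMeets 1) hs fun x =>
        Finset.sum_nonneg fun e _ => by split_ifs <;> norm_num
    have h2 := adjKilledGen_le_coalGen D hf hacc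
    have h3 := coalGen_one_le D hf
    intro x
    have h1x := congrFun h1 x
    have h2x := h2 x
    have h3x := h3 x
    simp only [map_sub, map_smul, Pi.sub_apply, Pi.smul_apply, Pi.neg_apply, smul_eq_mul,
      Pi.zero_apply] at h1x h2x h3x ⊢
    linarith

end Adjacent

/-! ### Meetings in the presence of a third particle -/

section Third

variable {V : Type*} [DecidableEq V] [Fintype V] {E : Finset (Finset V)} {f : EdgeWeights E}

/-- The action of permutations on triples of vertices. -/
def tripleAct (g : Equiv.Perm V) (q : V × V × V) : V × V × V := (g q.1, pairAct g q.2)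

/-- The last two particles of the triple are in the edge `e`. -/
def TripleMeets (e : {e // e ∈ E}) (q : V × V × V) : Prop := Meets e q.2

instance (e : {e // e ∈ E}) (q : V × V × V) : Decidable (TripleMeets e q) := by
  unfold TripleMeets; infer_instance

/-- The number of edges with four vertices that contain all three (distinct) particles. -/
def thirdRate (E : Finset (Finset V)) (q : V × V × V) : ℝ :=
  ∑ e : {e // e ∈ E}, if q.2.1 ≠ q.2.2 ∧ q.1 ≠ q.2.1 ∧ q.1 ≠ q.2.2 ∧ e.1.card = 4 ∧ q.1 ∈ e.1 ∧
    Meets e q.2 then 1 else 0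

/-- For a triple `(a, d, z)` of distinct particles, the probability that the first meeting of `d`
and `z` happens before time `t`, at an edge with four vertices that also contains `a`. -/
def thirdMeet (f : EdgeWeights E) (t : ℝ) : V × V × V → ℝ :=
  accum (killedGen f tripleAct TripleMeets 1) t (thirdRate E)

theorem thirdRate_nonneg : 0 ≤ thirdRate E := fun q =>
  Finset.sum_nonneg fun e _ => by split_ifs <;> norm_num

theorem thirdMeet_nonneg (hf : IsProbability f) {t : ℝ} (ht : 0 ≤ t) : 0 ≤ thirdMeet f t :=
  accum_nonneg (quasiPositive_killedGen hf _ 1) ht thirdRate_nonneg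

theorem thirdMeet_le_one (hf : IsProbability f) {t : ℝ} (ht : 0 ≤ t) : thirdMeet f t ≤ 1 := by
  have hQ := quasiPositive_killedGen (act := tripleAct) hf (TripleMeets (E := E) (V := V)) 1
  have h1 : thirdRate E ≤ -killedGen f tripleAct TripleMeets 1 1 := fun q => by
    rw [Pi.neg_apply, killedGen_one hf, ← Finset.sum_neg_distrib]
    refine Finset.sum_le_sum fun e _ => ?_
    split_ifs with h1 h2 h2
    · norm_num
    · exact absurd h1.2.2.2.2.2 h2
    · norm_num
    · norm_num
  refine (accum_mono hQ ht h1).trans ?_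
  rw [accum_neg_fun, accum_generator, neg_sub]
  exact sub_le_self _ (heat_nonneg hQ ht fun _ => zero_le_one)

/-- An edge with four vertices that contains `p` has room for two further particles only. -/
theorem sum_thirdRate_le (hf : IsProbability f) (p : V × V) : ∑ a, thirdRate E (a, p)
    ≤ ((2 : ℝ) • distinctMul (-killedGen f pairAct Meets 1 1)) p := by
  rw [Pi.smul_apply, distinctMul_apply, Pi.neg_apply, killedGen_one hf, ← Finset.sum_neg_distrib]
  simp only [thirdRate]
  rw [Finset.sum_comm, smul_eq_mul, Finset.mul_sum, Finset.mul_sum]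
  refine Finset.sum_le_sum fun e _ => ?_
  by_cases h : p.1 ≠ p.2 ∧ e.1.card = 4 ∧ Meets e p
  · rw [if_neg h.1, if_pos h.2.2, ← Finset.sum_filter, Finset.sum_const, nsmul_eq_mul, mul_one,
      neg_neg, one_mul, mul_one]
    have hsub : (Finset.univ.filter fun a => p.1 ≠ p.2 ∧ a ≠ p.1 ∧ a ≠ p.2 ∧ e.1.card = 4 ∧
        a ∈ e.1 ∧ Meets e p) ⊆ (e.1.erase p.1).erase p.2 := fun a ha => by
      simp only [Finset.mem_filter, Finset.mem_univ, true_and] at ha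
      simp only [Finset.mem_erase]
      tauto
    have hcard := Finset.card_le_card hsub
    rw [Finset.card_erase_of_mem (Finset.mem_erase.2 ⟨Ne.symm h.1, h.2.2.2⟩),
      Finset.card_erase_of_mem h.2.2.1] at hcard
    have h4 := h.2.1
    have h2 : (Finset.univ.filter fun a => p.1 ≠ p.2 ∧ a ≠ p.1 ∧ a ≠ p.2 ∧ e.1.card = 4 ∧
        a ∈ e.1 ∧ Meets e p).card ≤ 2 := by omega
    exact_mod_cast h2
  · rw [Finset.sum_eq_zero]
    · refine mul_nonneg zero_le_two (mul_nonneg ?_ ?_) <;> split_ifs <;> norm_num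
    · intro a _
      rw [if_neg]
      tauto

/-- Integrating the bound `sum_thirdRate_le` up to the first meeting of the pair `p`: summed over the
position `a` of the third particle, its total presence at this meeting is at most two. -/
theorem sum_thirdMeet_le (hf : IsProbability f) {t : ℝ} (ht : 0 ≤ t) (p : V × V) :
    ∑ a, thirdMeet f t (a, p) ≤ 2 * if p.1 = p.2 then 0 else 1 := by
  have hQ := quasiPositive_killedGen (act := pairAct) hf (Meets (E := E) (V := V)) 1
  let T : (V × V × V → ℝ) →ₗ[ℝ] (V × V → ℝ) :=
    LinearMap.pi fun p => ∑ a, LinearMap.proj (a, p)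
  have hT : ∀ u p, T u p = ∑ a, u (a, p) := fun u p => by simp [T]
  have hTK : ∀ u, T (killedGen f tripleAct TripleMeets 1 u)
      = killedGen f pairAct Meets 1 (T u) := by
    refine jumpOp_intertwine T (fun e σ u p => ?_) (fun e u p => ?_)
    · rw [hT, hT, ← Equiv.sum_comp (extend σ) fun a => u (a, pairAct (extend σ) p),
        Finset.mul_sum]
      rfl
    · rw [hT, hT, Finset.mul_sum]
      rfl
  have h1 : T (thirdMeet f t) p ≤ accum (killedGen f pairAct Meets 1) t
      ((2 : ℝ) • distinctMul (-killedGen f pairAct Meets 1 1)) p := by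
    rw [thirdMeet, map_accum _ T hTK]
    refine accum_mono hQ ht (fun p => ?_) p
    rw [hT]
    exact sum_thirdRate_le hf p
  rw [hT] at h1
  refine h1.trans ?_
  have h2 := map_accum (killedGen f pairAct Meets 1) (B := killedGen f pairAct Meets 1)
    ((2 : ℝ) • distinctMul) (fun u => by
      rw [LinearMap.smul_apply, LinearMap.smul_apply, map_smul, distinctMul_killedGen]) t
    (-killedGen f pairAct Meets 1 (1 : V × V → ℝ))
  rw [LinearMap.smul_apply, LinearMap.smul_apply] at h2
  rw [← h2, Pi.smul_apply, distinctMul_apply, smul_eq_mul, accum_neg_fun, accum_generator, neg_sub]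
  refine mul_le_mul_of_nonneg_left (mul_le_of_le_one_right (by split_ifs <;> norm_num) ?_)
    zero_le_two
  exact sub_le_self _ (heat_nonneg hQ ht (fun _ => zero_le_one) p)

theorem pairMean_sum_thirdMeet_le (hf : IsProbability f) (hV : 2 ≤ Fintype.card V) {t : ℝ}
    (ht : 0 ≤ t) : pairMean (fun p : V × V => ∑ z, thirdMeet f t (p.1, p.2, z)) ≤ 2 := by
  have hn : (2 : ℝ) ≤ Fintype.card V := by exact_mod_cast hV
  rw [pairMean, div_le_iff₀ (by nlinarith)]
  have h1 : ∑ p ∈ (Finset.univ : Finset V).offDiag, ∑ z, thirdMeet f t (p.1, p.2, z)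
      ≤ ∑ p : V × V, ∑ z, thirdMeet f t (p.1, p.2, z) :=
    Finset.sum_le_univ_sum_of_nonneg fun p =>
      Finset.sum_nonneg fun z _ => thirdMeet_nonneg hf ht _
  have h2 : ∑ p : V × V, ∑ z, thirdMeet f t (p.1, p.2, z)
      = ∑ p : V × V, ∑ a, thirdMeet f t (a, p) := by
    simp only [Fintype.sum_prod_type]
    rw [Finset.sum_comm]
    exact Finset.sum_congr rfl fun d _ => Finset.sum_comm
  have h3 : ∑ p : V × V, (2 * if p.1 = p.2 then (0 : ℝ) else 1)
      = 2 * (Fintype.card V * (Fintype.card V - 1)) := by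
    rw [← Finset.mul_sum, Fintype.sum_prod_type]
    have : ∀ d : V, ∑ z, (if d = z then (0 : ℝ) else 1) = Fintype.card V - 1 := fun d => by
      have : ∀ z, (if d = z then (0 : ℝ) else 1) = 1 - if d = z then 1 else 0 := fun z => by
        split_ifs <;> norm_num
      simp [this, Finset.sum_sub_distrib]
    simp [this]
    ring
  calc _ ≤ _ := h1
    _ = _ := h2
    _ ≤ _ := Finset.sum_le_sum fun p _ => sum_thirdMeet_le hf ht p
    _ = _ := h3

end Third

/-! ### Contraction through coalescence -/

section Contraction

variable {V : Type*} [DecidableEq V] [Fintype V] {E : Finset (Finset V)} {f : EdgeWeights E}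
  {m : ℕ}

theorem accum_obstructedRate_le (hf : IsProbability f) {t : ℝ} (ht : 0 ≤ t) (s : ℝ) (hs : 0 ≤ s)
    (x : Adjacent V m) :
    heat (ringGen f adjAct) s (accum (adjKilledGen f m) t (obstructedRate E)) x
      ≤ ∑ a ∈ x.1.1, heat (ringGen f tripleAct) s (thirdMeet f t) (a, x.1.2) := by
  let T : (V × V × V → ℝ) →ₗ[ℝ] (Adjacent V m → ℝ) :=
    LinearMap.pi fun x => ∑ a ∈ x.1.1, LinearMap.proj (a, x.1.2)
  have hT : ∀ u x, T u x = ∑ a ∈ x.1.1, u (a, x.1.2) := fun u p => by simp [T]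
  have himage : ∀ (g : Equiv.Perm V) (u : V × V × V → ℝ) (x : Adjacent V m),
      T u (adjAct g x) = ∑ a ∈ x.1.1, u (tripleAct g (a, x.1.2)) := fun g u x => by
    rw [hT]
    exact Finset.sum_image fun a _ b _ h => g.injective h
  have hTK : ∀ u, T (killedGen f tripleAct TripleMeets 1 u) = adjKilledGen f m (T u) := by
    refine jumpOp_intertwine T (fun e σ u x => ?_) (fun e u x => ?_)
    · rw [himage, hT, Finset.mul_sum]
      rfl
    · rw [hT, hT, Finset.mul_sum]
      rfl
  have hTL : ∀ u, T (ringGen f tripleAct u) = ringGen f adjAct (T u) :=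
    ringGen_intertwine T fun g u x => by rw [himage, hT]
  rw [← hT, map_heat _ T hTL]
  refine heat_mono (quasiPositive_ringGen hf) hs ?_ x
  rw [thirdMeet, map_accum _ T hTK]
  refine accum_mono (quasiPositive_killedGen hf AdjMeets 1) ht fun y => ?_
  rw [hT]
  simp only [obstructedRate, thirdRate]
  rw [Finset.sum_comm]
  refine Finset.sum_le_sum fun e _ => ?_
  have hnn : ∀ a ∈ y.1.1, (0 : ℝ) ≤ if y.1.2.1 ≠ y.1.2.2 ∧ a ≠ y.1.2.1 ∧ a ≠ y.1.2.2 ∧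
      e.1.card = 4 ∧ a ∈ e.1 ∧ Meets e y.1.2 then 1 else 0 := fun a _ => by
    split_ifs <;> norm_num
  split_ifs with h
  · obtain ⟨a, ha⟩ := Finset.card_eq_one.1 h.2.2
    have ha' : a ∈ e.1 ∩ y.1.1 := by rw [ha]; exact Finset.mem_singleton_self a
    rw [Finset.mem_inter] at ha'
    have := Finset.single_le_sum hnn ha'.2
    rw [if_pos ⟨y.2.2.2.2, fun h => y.2.2.1 (h ▸ ha'.2), fun h => y.2.2.2.1 (h ▸ ha'.2), h.2.1,
      ha'.1, h.1⟩] at this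
    exact this
  · exact Finset.sum_nonneg hnn

/-- The pairs of adjacent configurations with a given left configuration and given common
particles. -/
def withRight {C : Finset V} {d : V} (hC : C.card = m) (hd : d ∉ C) (z : {z // z ∉ C ∧ d ≠ z}) :
    Adjacent V m := ⟨(C, d, z.1), hC, hd, z.2.1, z.2.2⟩

theorem card_right_le {C : Finset V} {d : V} (hC : C.card = m) :
    (Fintype.card {z // z ∉ C ∧ d ≠ z} : ℝ) ≤ Fintype.card V - m := by
  have h1 : Fintype.card {z // z ∉ C ∧ d ≠ z} ≤ Fintype.card {z // z ∉ C} :=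
    Fintype.card_subtype_mono _ _ fun z hz => hz.1
  have h2 : Fintype.card {z // z ∉ C} = Fintype.card V - m := by
    rw [Fintype.card_subtype_compl, Fintype.card_coe, hC]
  have h3 : m ≤ Fintype.card V := hC ▸ Finset.card_le_univ C
  rw [h2] at h1
  rw [← Nat.cast_sub h3]
  exact_mod_cast h1

/-- For a uniformly chosen second discrepancy the probability of a failure is small, since the
other particles are rarely present at the first meeting. -/
theorem sum_heat_failure_le (hf : IsProbability f) (hV : 2 ≤ Fintype.card V) {s t ρ η : ℝ}
    (hs : 0 ≤ s) (ht : 0 ≤ t) (hη0 : 0 ≤ η)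
    (hosc : OscContracts (ringGen f (setAct (V := V) 2)) s ρ)
    (hη : ∀ x y : V, x ≠ y → noMeet f t (x, y) ≤ η) {C : Finset V} {d : V} (hC : C.card = m)
    (hd : d ∉ C) :
    ∑ z, heat (ringGen f adjAct) s (failure f m t) (withRight hC hd z)
      ≤ (Fintype.card V - m) * η + m * (4 + 2 * ρ * Fintype.card V) := by
  have hQ3 := quasiPositive_ringGen (act := tripleAct) hf
  have hW0 : 0 ≤ heat (ringGen f tripleAct) s (thirdMeet f t) :=
    heat_nonneg hQ3 hs (thirdMeet_nonneg hf ht)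
  have h1 : ∀ x : Adjacent V m, heat (ringGen f adjAct) s (failure f m t) x
      ≤ η + ∑ a ∈ x.1.1, heat (ringGen f tripleAct) s (thirdMeet f t) (a, x.1.2) := fun x => by
    rw [failure, heat_add_fun]
    refine add_le_add ?_ (accum_obstructedRate_le hf ht s hs x)
    have h2 : heat (adjKilledGen f m) t 1 ≤ fun _ => η := fun y => by
      have hφ : ∀ (g : Equiv.Perm V) (y : Adjacent V m),
        (adjAct g y).1.2 = pairAct g y.1.2 := fun _ _ => rfl
      have h3 : noMeet f t y.1.2 = heat (adjKilledGen f m) t 1 y :=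
        heat_comp (φ := fun y : Adjacent V m => y.1.2)
          (killedGen_comp hφ fun _ _ => Iff.rfl) t 1 y
      rw [← h3]
      exact hη _ _ y.2.2.2.2
    refine (heat_mono (quasiPositive_ringGen hf) hs h2 x).trans_eq ?_
    rw [heat_const (ringGen_one hf)]
  let T : (V × V × V → ℝ) →ₗ[ℝ] (V × V → ℝ) :=
    LinearMap.pi fun p => ∑ z, LinearMap.proj (p.1, p.2, z)
  have hT : ∀ u p, T u p = ∑ z, u (p.1, p.2, z) := fun u p => by simp [T]
  have hTL := map_heat (ringGen f tripleAct) T (ringGen_intertwine (act' := pairAct) T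
    fun g u p => by
      rw [hT, hT]
      exact Equiv.sum_comp g fun z => u (g p.1, g p.2, z)) s (thirdMeet f t)
  have h2 : ∀ a ∈ C, ∑ z : {z // z ∉ C ∧ d ≠ z},
      heat (ringGen f tripleAct) s (thirdMeet f t) (a, d, z.1)
      ≤ 4 + 2 * ρ * Fintype.card V := fun a ha => by
    have had : a ≠ d := fun h => hd (h ▸ ha)
    have h3 : ∑ z : {z // z ∉ C ∧ d ≠ z},
        heat (ringGen f tripleAct) s (thirdMeet f t) (a, d, z.1)
        ≤ ∑ z, heat (ringGen f tripleAct) s (thirdMeet f t) (a, d, z) := by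
      rw [← Finset.sum_subtype (Finset.univ.filter fun z => z ∉ C ∧ d ≠ z) (by simp)
        fun z => heat (ringGen f tripleAct) s (thirdMeet f t) (a, d, z)]
      exact Finset.sum_le_univ_sum_of_nonneg fun z => hW0 _
    refine h3.trans ?_
    rw [← hT _ (a, d), hTL]
    refine (heat_pair_le hf hs hosc (M := Fintype.card V) (fun p => ?_) had).trans ?_
    · rw [hT]
      refine ⟨Finset.sum_nonneg fun z _ => thirdMeet_nonneg hf ht _, ?_⟩
      refine (Finset.sum_le_card_nsmul _ _ 1 fun z _ =>
        thirdMeet_le_one hf ht (p.1, p.2, z)).trans ?_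
      simp
    · have h4 := pairMean_sum_thirdMeet_le hf hV ht
      have h5 : T (thirdMeet f t) = fun p => ∑ z, thirdMeet f t (p.1, p.2, z) :=
        funext fun p => hT _ p
      rw [h5]
      linarith
  calc _ ≤ ∑ z : {z // z ∉ C ∧ d ≠ z},
        (η + ∑ a ∈ C, heat (ringGen f tripleAct) s (thirdMeet f t) (a, d, z.1)) :=
        Finset.sum_le_sum fun z _ => h1 (withRight hC hd z)
    _ = Fintype.card {z // z ∉ C ∧ d ≠ z} * η + ∑ a ∈ C, ∑ z : {z // z ∉ C ∧ d ≠ z},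
        heat (ringGen f tripleAct) s (thirdMeet f t) (a, d, z.1) := by
        rw [Finset.sum_add_distrib, Finset.sum_comm]
        simp
    _ ≤ _ := by
        refine add_le_add (mul_le_mul_of_nonneg_right (card_right_le hC) hη0) ?_
        refine (Finset.sum_le_card_nsmul _ _ _ h2).trans_eq ?_
        rw [hC, nsmul_eq_mul]

/-- After the pairs have mixed during time `s`, each further window of length `t` leaves the coupling
uncoalesced only with the factor `59 / 60`, up to the failures, which are few on average over the
second discrepancy. -/
theorem sum_heat_coalGen_le (hf : IsProbability f) (hV : 2 ≤ Fintype.card V)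
    (D : CoalescingData f m) {s t ρ η : ℝ} (hs : 0 ≤ s) (ht : 0 ≤ t) (hη0 : 0 ≤ η)
    (hosc : OscContracts (ringGen f (setAct (V := V) 2)) s ρ)
    (hη : ∀ x y : V, x ≠ y → noMeet f t (x, y) ≤ η) {C : Finset V} {d : V} (hC : C.card = m)
    (hd : d ∉ C) (j : ℕ) :
    ∑ z, heat (coalGen D) (s + j * t) 1 (withRight hC hd z)
      ≤ (Fintype.card V - m) * η + m * (4 + 2 * ρ * Fintype.card V)
        + (59 / 60) ^ j * (Fintype.card V - m) := by
  set Φ := (Fintype.card V - m) * η + m * (4 + 2 * ρ * Fintype.card V) with hΦ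
  have hK := quasiPositive_coalGen D hf
  have hΦ' : ∀ j : ℕ,
      ∑ z, heat (coalGen D) (s + j * t) (failure f m t) (withRight hC hd z) ≤ Φ := by
    intro j
    have hjt : 0 ≤ j * t := by positivity
    have hosc' : OscContracts (ringGen f (setAct (V := V) 2)) (s + j * t) ρ := by
      have := hosc.add (oscContracts_one (quasiPositive_ringGen hf) (ringGen_one hf) hjt)
      rwa [mul_one] at this
    refine le_trans (Finset.sum_le_sum fun z _ => ?_)
      (sum_heat_failure_le hf hV (add_nonneg hs hjt) ht hη0 hosc' hη hC hd)
    exact heat_le_heat hK (quasiPositive_ringGen hf) (fun u hu => coalGen_le_ringGen D hf hu)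
      (add_nonneg hs hjt) (failure_nonneg hf ht) _
  have hΦ0 : 0 ≤ Φ := le_trans (Finset.sum_nonneg fun z _ =>
    heat_nonneg hK (by positivity) (failure_nonneg hf ht) _) (hΦ' 0)
  have hcard := card_right_le (V := V) (d := d) hC
  induction j with
  | zero =>
    have h1 : ∑ z, heat (coalGen D) (s + (0 : ℕ) * t) 1 (withRight hC hd z)
        ≤ Fintype.card {z // z ∉ C ∧ d ≠ z} := by
      refine (Finset.sum_le_card_nsmul _ _ 1 fun z _ => ?_).trans_eq (by simp)
      refine heat_one_le hK ((coalGen_one_le D hf).trans fun x => ?_) (by simpa using hs) _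
      simp only [Pi.neg_apply, Pi.smul_apply, smul_eq_mul, Pi.zero_apply, Left.neg_nonpos_iff]
      exact mul_nonneg (by norm_num) (Finset.sum_nonneg fun e _ => by split_ifs <;> norm_num)
    rw [pow_zero, one_mul]
    linarith
  | succ j ih =>
    have h1 : ∀ z, heat (coalGen D) (s + (j + 1 : ℕ) * t) 1 (withRight hC hd z)
        ≤ 59 / 60 * heat (coalGen D) (s + j * t) 1 (withRight hC hd z)
          + 1 / 60 * heat (coalGen D) (s + j * t) (failure f m t) (withRight hC hd z) := fun z => by
      have h2 : s + ((j + 1 : ℕ) : ℝ) * t = (s + j * t) + t := by push_cast; ring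
      have h3 := heat_mono hK (t := s + j * t) (by positivity) (heat_coalGen_one_le D hf ht)
        (withRight hC hd z)
      rw [heat_sub_fun, heat_smul_fun, heat_sub_fun] at h3
      rw [h2, heat_add]
      simp only [Pi.sub_apply, Pi.smul_apply, smul_eq_mul] at h3
      linarith
    have h2 := Finset.sum_le_sum fun z (_ : z ∈ Finset.univ) => h1 z
    rw [Finset.sum_add_distrib, ← Finset.mul_sum, ← Finset.mul_sum] at h2
    have h3 := hΦ' j
    rw [pow_succ]
    linarith

/-- Comparing both configurations of an adjacent pair with a configuration whose last particle is
uniform turns a bound for uniform discrepancies into a bound for all of them. -/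
theorem abs_adjDiff_heat_le_of_sum_le (hf : IsProbability f) (D : CoalescingData f m) {t q ℓ : ℝ}
    (ht : 0 ≤ t) (hℓ : 0 ≤ ℓ)
    (hq : ∀ (C : Finset V) (d : V) (hC : C.card = m) (hd : d ∉ C),
      ∑ z, heat (coalGen D) t 1 (withRight hC hd z) ≤ q * (Fintype.card V - m))
    {h : {A : Finset V // A.card = m + 1} → ℝ} (hh : ∀ x : Adjacent V m, |adjDiff h x| ≤ ℓ)
    (x : Adjacent V m) :
    |adjDiff (heat (ringGen f (setAct (m + 1))) t h) x| ≤ 2 * q * ℓ := by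
  obtain ⟨⟨C, d, z⟩, hC, hd, hz, hdz⟩ := x
  simp only at hC hd hz hdz
  set u := heat (ringGen f (setAct (m + 1))) t h
  let F : {v // v ∉ C} → ℝ := fun v =>
    u ⟨insert v.1 C, by rw [Finset.card_insert_of_notMem v.2, hC]⟩
  have hN : (0 : ℝ) < Fintype.card V - m := by
    have h1 : m + 1 ≤ Fintype.card V := by
      rw [← hC, ← Finset.card_insert_of_notMem hd]
      exact Finset.card_le_univ _
    have : ((m + 1 : ℕ) : ℝ) ≤ Fintype.card V := by exact_mod_cast h1
    push_cast at this
    linarith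
  have hNcard : (Fintype.card {v // v ∉ C} : ℝ) = Fintype.card V - m := by
    rw [Fintype.card_subtype_compl, Fintype.card_coe, hC,
      Nat.cast_sub (hC ▸ Finset.card_le_univ C)]
  have key : ∀ d : {v // v ∉ C}, |∑ v, (F d - F v)| ≤ ℓ * (q * (Fintype.card V - m)) := by
    intro d
    have h1 : ∑ v, |F d - F v| = ∑ v : {v // v ∉ C ∧ d.1 ≠ v}, |F d - F ⟨v.1, v.2.1⟩| := by
      rw [← Finset.sum_subset (Finset.filter_subset (fun v => d ≠ v) Finset.univ)
        fun v _ hv => by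
          rw [Finset.mem_filter, not_and, not_not] at hv
          rw [← hv (Finset.mem_univ v), sub_self, abs_zero]]
      refine Finset.sum_bij' (fun v hv => ⟨v.1, v.2, fun h => (Finset.mem_filter.1 hv).2
        (Subtype.ext h)⟩) (fun v _ => ⟨v.1, v.2.1⟩) ?_ ?_ ?_ ?_ ?_
      · simp
      · intro v _
        simpa using fun h => v.2.2 (congrArg Subtype.val h)
      · simp
      · simp
      · simp
    refine (Finset.abs_sum_le_sum_abs _ _).trans ?_
    rw [h1]
    calc _ ≤ ∑ v : {v // v ∉ C ∧ d.1 ≠ v}, ℓ * heat (coalGen D) t 1 (withRight hC d.2 v) :=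
          Finset.sum_le_sum fun v _ => abs_adjDiff_heat_le D hf ht hh (withRight hC d.2 v)
      _ ≤ _ := by
          rw [← Finset.mul_sum]
          exact mul_le_mul_of_nonneg_left (hq C d.1 hC d.2) hℓ
  have h1 := key ⟨d, hd⟩
  have h2 := key ⟨z, hz⟩
  have h3 : (Fintype.card V - m : ℝ) * adjDiff u ⟨(C, d, z), hC, hd, hz, hdz⟩
      = ∑ v, (F ⟨d, hd⟩ - F v) - ∑ v, (F ⟨z, hz⟩ - F v) := by
    rw [← Finset.sum_sub_distrib]
    simp only [sub_sub_sub_cancel_right, Finset.sum_const, Finset.card_univ, nsmul_eq_mul, hNcard]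
    rfl
  have h4 := abs_sub (∑ v, (F ⟨d, hd⟩ - F v)) (∑ v, (F ⟨z, hz⟩ - F v))
  rw [← h3, abs_mul, abs_of_pos hN] at h4
  have h5 : (Fintype.card V - m : ℝ) * |adjDiff u ⟨(C, d, z), hC, hd, hz, hdz⟩|
      ≤ (Fintype.card V - m) * (2 * q * ℓ) := by linarith
  exact le_of_mul_le_mul_left h5 hN

/-- Any two configurations are connected by replacing one particle at a time. -/
theorem sub_le_of_adjDiff_le {ℓ : ℝ} (hℓ : 0 ≤ ℓ) {h : {A : Finset V // A.card = m + 1} → ℝ}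
    (hh : ∀ x : Adjacent V m, |adjDiff h x| ≤ ℓ) (A B : {A : Finset V // A.card = m + 1}) :
    h A - h B ≤ (m + 1) * ℓ := by
  have key : ∀ k : ℕ, ∀ A B : {A : Finset V // A.card = m + 1}, (A.1 \ B.1).card = k →
      h A - h B ≤ k * ℓ := by
    intro k
    induction k with
    | zero =>
      intro A B hAB
      have h1 : A.1 ⊆ B.1 := by
        rw [← Finset.sdiff_eq_empty_iff_subset, ← Finset.card_eq_zero, hAB]
      have h2 : A = B := Subtype.ext (Finset.eq_of_subset_of_card_le h1 (by rw [A.2, B.2]))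
      simp [h2]
    | succ k ih =>
      intro A B hAB
      obtain ⟨d, hd⟩ : (A.1 \ B.1).Nonempty := by rw [← Finset.card_pos]; omega
      obtain ⟨z, hz⟩ : (B.1 \ A.1).Nonempty := by
        have := Finset.card_sdiff_comm (s := A.1) (t := B.1) (by rw [A.2, B.2])
        rw [← Finset.card_pos]; omega
      rw [Finset.mem_sdiff] at hd hz
      have hne : d ≠ z := fun h => hd.2 (h ▸ hz.1)
      let x : Adjacent V m := ⟨(A.1.erase d, d, z), by rw [Finset.card_erase_of_mem hd.1, A.2]; rfl,
        Finset.notMem_erase d A.1, fun h => hz.2 (Finset.mem_of_mem_erase h), hne⟩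
      have hl : x.left = A := Subtype.ext (Finset.insert_erase hd.1)
      have hx := (abs_le.1 (hh x)).2
      rw [adjDiff_apply, hl] at hx
      have hr := ih x.right B (by
        have h1 : x.right.1 \ B.1 = (A.1 \ B.1).erase d := by
          ext v
          simp only [x, Adjacent.right, Finset.mem_sdiff, Finset.mem_insert, Finset.mem_erase]
          constructor
          · rintro ⟨rfl | h1, h2⟩
            · exact absurd hz.1 h2
            · exact ⟨h1.1, h1.2, h2⟩
          · rintro ⟨h1, h2, h3⟩
            exact ⟨Or.inr ⟨h1, h2⟩, h3⟩
        rw [h1, Finset.card_erase_of_mem (Finset.mem_sdiff.2 hd), hAB]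
        rfl)
      push_cast
      linarith
  refine (key _ A B rfl).trans (mul_le_mul_of_nonneg_right ?_ hℓ)
  have := Finset.card_le_card (Finset.sdiff_subset (s := A.1) (t := B.1))
  rw [A.2] at this
  exact_mod_cast this

/-- If on average over the second discrepancy the coupling has not coalesced with probability
at most `q`, then every window contracts the differences between adjacent configurations by `2 * q`,
and `m + 1` adjacent steps join any two configurations. -/
theorem oscContracts_of_coalescence (hf : IsProbability f) (D : CoalescingData f m) {t q : ℝ}
    (ht : 0 ≤ t) (hq0 : 0 ≤ q)
    (hq : ∀ (C : Finset V) (d : V) (hC : C.card = m) (hd : d ∉ C),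
      ∑ z, heat (coalGen D) t 1 (withRight hC hd z) ≤ q * (Fintype.card V - m)) (r : ℕ) :
    OscContracts (ringGen f (setAct (V := V) (m + 1))) (r * t) ((m + 1) * (2 * q) ^ r) := by
  refine oscContracts_of_unit (ringGen_one hf) fun h hh A B =>
    sub_le_of_adjDiff_le (by positivity) (fun x => ?_) A B
  induction r generalizing x with
  | zero =>
    simp only [Nat.cast_zero, zero_mul, heat_zero, pow_zero]
    rw [adjDiff_apply]
    exact abs_le.2 ⟨by linarith [(hh x.left).1, (hh x.right).2],
      by linarith [(hh x.left).2, (hh x.right).1]⟩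
  | succ r ih =>
    have h1 : ((r + 1 : ℕ) : ℝ) * t = t + r * t := by push_cast; ring
    rw [h1, heat_add, pow_succ, mul_comm ((2 * q) ^ r)]
    exact abs_adjDiff_heat_le_of_sum_le hf D ht (by positivity) hq ih x

end Contraction

/-! ### The dichotomy -/

section Dichotomy

variable {V : Type*} [DecidableEq V] [Fintype V] {E : Finset (Finset V)} {f : EdgeWeights E}

/-- If a uniform pair meets with probability bounded below, every pair does so after mixing, and
then four particles mix through coalescence: a uniform second discrepancy fails to coalesce with
probability about `12 / (|V| - 3) < 1 / 2`. -/
theorem oscContracts_four_of_often_meet (hf : IsProbability f) (hadm : Admissible f)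
    (hV : 36 ≤ Fintype.card V) {b : ℝ} (hb : 0 ≤ b)
    (hosc : OscContracts (ringGen f (setAct (V := V) 2)) b ((1 / 2) ^ 14))
    (hδ : 1 / 2000 < pairMean (fun p : V × V => 1 - noMeet f b p)) {l J r : ℕ}
    (hl : (1 - 1 / 4000 : ℝ) ^ l ≤ 1 / 1000) (hJ : (59 / 60 : ℝ) ^ J ≤ 1 / 10)
    (hr : (94 / 100 : ℝ) ^ r ≤ 1 / 16) :
    OscContracts (ringGen f (setAct (V := V) 4)) (r * (b + J * (l * (b + b)))) (1 / 4) := by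
  have hn : (36 : ℝ) ≤ Fintype.card V := by exact_mod_cast hV
  have h1 : ∀ x y : V, x ≠ y → noMeet f (b + b) (x, y) ≤ 1 - 1 / 4000 := fun x y hxy => by
    have := noMeet_add_le hf hb hb hosc hxy
    norm_num at this hδ ⊢
    linarith
  have h2 : ∀ x y : V, x ≠ y → noMeet f (l * (b + b)) (x, y) ≤ 1 / 1000 := fun x y hxy =>
    (noMeet_nsmul_le hf (add_nonneg hb hb) h1 (by norm_num) l hxy).trans hl
  obtain ⟨D⟩ := nonempty_coalescingData hf hadm 3
  have h3 := oscContracts_of_coalescence hf D (t := b + J * (l * (b + b))) (q := 47 / 100)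
    (by positivity) (by norm_num) (fun C d hC hd => by
      refine (sum_heat_coalGen_le hf (by omega) D hb (by positivity) (by norm_num) hosc h2 hC hd
        J).trans ?_
      -- `12 ≤ 12 / 33 * (|V| - 3)`, and `12 / 33 + 1 / 1000 + 1 / 10` leaves room below `47 / 100`
      have h4 := mul_le_mul_of_nonneg_right hJ
        (show (0 : ℝ) ≤ Fintype.card V - (3 : ℕ) by push_cast; linarith)
      push_cast at h4 ⊢
      norm_num at h4 ⊢
      linarith) r
  refine h3.mono ?_
  norm_num at hr ⊢
  linarith

/-- A multiple of the contraction time of two particles is a contraction time of four. -/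
theorem oscContracts_four_of_two (hf : IsProbability f) (hadm : Admissible f)
    (hV : 36 ≤ Fintype.card V) {t : ℝ} (ht : 0 ≤ t)
    (hosc : OscContracts (ringGen f (setAct (V := V) 2)) t (1 / 2)) {l J r : ℕ}
    (hl : (1 - 1 / 4000 : ℝ) ^ l ≤ 1 / 1000) (hJ : (59 / 60 : ℝ) ^ J ≤ 1 / 10)
    (hr : (94 / 100 : ℝ) ^ r ≤ 1 / 16) :
    OscContracts (ringGen f (setAct (V := V) 4)) (28 * t) (1 / 4) ∨
      OscContracts (ringGen f (setAct (V := V) 4)) (r * (14 + J * (l * 28)) * t) (1 / 4) := by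
  -- fourteen contractions make the error terms small against `1 / 2000`
  have hb := hosc.nsmul 14
  have hb0 : (0 : ℝ) ≤ (14 : ℕ) * t := by positivity
  rcases le_or_gt (pairMean (fun p : V × V => 1 - noMeet f ((14 : ℕ) * t) p)) (1 / 2000) with h | h
  · left
    have h1 := oscContracts_of_rarely_meet (k := 4) hf (by omega) (by norm_num) (by norm_num)
      (by norm_num) hb0 hb h
    rw [show (28 : ℝ) * t = (14 : ℕ) * t + (14 : ℕ) * t by push_cast; ring]
    exact h1.mono (by norm_num)
  · right
    have h1 := oscContracts_four_of_often_meet hf hadm hV hb0 hb h hl hJ hr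
    rwa [show (r : ℝ) * (14 + J * (l * 28)) * t
      = r * ((14 : ℕ) * t + J * (l * ((14 : ℕ) * t + (14 : ℕ) * t))) by push_cast; ring]

end Dichotomy

end

end HypEx

theorem lemma4 :
    ∃ lam : NNReal, 0 < lam ∧
      ∀ (V : Type*) [Fintype V] [DecidableEq V] (E : Finset (Finset V)) (f : HypEx.EdgeWeights E),
        36 ≤ Fintype.card V →
        HypEx.IsRegular E →
        HypEx.IsProbability f →
        HypEx.Admissible f →
        HypEx.exclusionMixingTime 4 f (1 / 4) ≤
          (lam : ENNReal) * HypEx.exclusionMixingTime 2 f (1 / 4) := by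
  obtain ⟨l, hl⟩ := exists_pow_lt_of_lt_one (show (0 : ℝ) < 1 / 1000 by norm_num)
    (show (1 - 1 / 4000 : ℝ) < 1 by norm_num)
  obtain ⟨J, hJ⟩ := exists_pow_lt_of_lt_one (show (0 : ℝ) < 1 / 10 by norm_num)
    (show (59 / 60 : ℝ) < 1 by norm_num)
  obtain ⟨r, hr⟩ := exists_pow_lt_of_lt_one (show (0 : ℝ) < 1 / 16 by norm_num)
    (show (94 / 100 : ℝ) < 1 by norm_num)
  let lam : NNReal := 28 + r * (14 + J * (l * 28))
  have hpos : 0 < lam := lt_of_lt_of_le (by norm_num : (0 : NNReal) < 28) le_self_add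
  refine ⟨lam, hpos, fun V _ _ E f hV _ hf hadm => ?_⟩
  have hpos' : (lam : ENNReal) ≠ 0 := by exact_mod_cast hpos.ne'
  have main : ∀ t : NNReal, (∀ p, HypEx.IsEquilibrium (HypEx.exclusionRate 2 f) p →
      ∀ x, HypEx.tvDist (HypEx.transition (HypEx.exclusionRate 2 f) t x) p ≤ 1 / 4) →
      HypEx.exclusionMixingTime 4 f (1 / 4) ≤ (lam : ENNReal) * t := fun t ht => by
    have hosc := HypEx.oscContracts_of_tvDist_le hf ht
    rw [show (2 : ℝ) * (1 / 4) = 1 / 2 by norm_num] at hosc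
    rcases HypEx.oscContracts_four_of_two hf hadm hV t.2 hosc hl.le hJ.le hr.le with h | h
    · have h1 := HypEx.exclusionMixingTime_le hf (28 * t) (by push_cast; exact h)
      refine h1.trans ?_
      rw [← ENNReal.coe_mul]
      exact ENNReal.coe_le_coe.2 (mul_le_mul_of_nonneg_right le_self_add t.2)
    · have h1 := HypEx.exclusionMixingTime_le hf (r * (14 + J * (l * 28)) * t)
        (by push_cast; exact h)
      refine h1.trans ?_
      rw [← ENNReal.coe_mul]
      exact ENNReal.coe_le_coe.2 (mul_le_mul_of_nonneg_right le_add_self t.2)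
  rw [HypEx.exclusionMixingTime.eq_def 2, HypEx.mixingTime,
    ENNReal.mul_iInf_of_ne hpos' ENNReal.coe_ne_top]
  refine le_iInf fun t => ?_
  rw [ENNReal.mul_iInf_of_ne hpos' ENNReal.coe_ne_top]
  exact le_iInf fun ht => main t ht
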